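/- **Theorem (quantum mirror curve of the resolved conifold).** Work with formal series in a coupling constant $\lambda$ (Laurent series) and in $e^{-t}$ (power series), and put $q^{s}=e^{\sqrt{-1}\,s\lambda}$, $[n]=q^{n/2}-q^{-n/2}$, $Q=-e^{-t}$. For a partition $\mu$ let $l(\mu)$ be its length, $\mu^t$ its conjugate, $\kappa_\mu=\sum_i\mu_i(\mu_i-2i+1)$, $\chi_\mu$ the irreducible character of the symmetric group $S_{|\mu|}$ indexed by $\mu$ (with $\chi_{(n)}=1$), and $z_\mu=\prod_i i^{m_i}m_i!$, where $m_i$ is the number of parts of $\mu$ equal to $i$. Let $$C_{\mu^1,\mu^2,\mu^3}(q)=q^{(\kappa_{\mu^2}+\kappa_{\mu^3})/2}\,s_{(\mu^2)^t}(q^{\rho})\sum_\eta s_{\mu^1/\eta}(q^{(\mu^2)^t+\rho})\,s_{(\mu^3)^t/\eta}(q^{\mu^2+\rho})$$ be the topological vertex, where $s_{\mu/\eta}(q^{\nu+\rho})$ is the skew Schur function at the power sums $$p_n(q^{\nu+\rho})=\sum_{i=1}^{l(\nu)}\bigl(q^{n(\nu_i-i+1/2)}-q^{n(-i+1/2)}\bigr)+\frac1{[n]},\qquad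 n\ge 1.$$ For a framing $a\in\mathbb Z$, the open string amplitude of the resolved conifold with one framed outer brane is the formal series in $p_1,p_2,\dots$ (with $p_\eta=\prod_i p_{\eta_i}$) $$\tilde Z^{(a)}(p)=\sum_{\mu,\nu}\ \sum_{|\eta|=|\mu|} q^{a\kappa_\mu/2}\,C_{\mu,\emptyset,\nu^t}(q)\,Q^{|\nu|}\,C_{\nu,\emptyset,\emptyset}(q)\,\frac{\chi_\mu(\eta)}{z_\eta\sqrt{-1}^{\,l(\eta)}}\,p_\eta .$$ Let $F_\mu$ be the coefficient of $p_\mu$ in $\log\bigl(\tilde Z^{(a)}(p)/\tilde Z^{(a)}(0)\bigr)$ (in its genus expansion, $F_\mu=\sum_{g,k\ge0}F_{g;k;\mu}\lambda^{2g-2+l(\mu)}e^{-kt}$), and for $n\ge1$ put $$\Phi_n(x_1,\dots,x_n)=\sum_{l(\mu)=n}\sqrt{-1}^{\,n}F_\mu\sum_{\sigma\in S_n}x_{\sigma(1)}^{\mu_1}\cdots x_{\sigma(n)}^{\mu_n}$$ (that is, $\Phi_n=\sum_{g\ge0}\lambda^{2g-2+n}\Phi_{g,n}$). Then the partition function $$Z(x)=\exp\sum_{n\ge1}\frac1{n!}\,\Phi_n(x,\dots,x)$$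 satisfies $$\bigl(1-\hat y+q^{1/2}\,\hat x\,\hat y^{\,a+1}-q^{1/2}e^{-t}\,\hat x\,\hat y^{\,a}\bigr)Z=0,\qquad \hat x=x\,\cdot\,,\quad \hat y=e^{\sqrt{-1}\,\lambda x\frac{\partial}{\partial x}} .$$ Thus the Gukov–Sułkowski quantum curve for the framed mirror curve of the resolved conifold holds, with the correction $\hat x\mapsto q^{1/2}x$. -/

import Mathlib

open scoped PowerSeries

noncomputable section

namespace Conifold

/-! ### Coefficient rings -/

/-- Formal Laurent series in the string coupling `λ`. -/
abbrev CouplingField : Type := LaurentSeries ℂ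

/-- Formal power series in `T = e^{-t}` with coefficients Laurent series in `λ`. -/
abbrev CoeffRing : Type := PowerSeries CouplingField

/-- `q^s = e^{√-1 s λ}`, as a formal series in `λ`; so `q = qPow 1`. -/
def qPow (s : ℂ) : CouplingField :=
  HahnSeries.ofPowerSeries ℤ ℂ (PowerSeries.rescale (Complex.I * s) (PowerSeries.exp ℂ))

theorem qPow_zero : qPow 0 = 1 := by
  simp [qPow, PowerSeries.rescale_zero]

theorem qPow_add (s t : ℂ) : qPow (s + t) = qPow s * qPow t := by
  simp only [qPow]
  rw [← map_mul, PowerSeries.exp_mul_exp_eq_exp_add, mul_add]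

/-- The quantum number `[n] = q^{n/2} - q^{-n/2}`. -/
def qNumber (n : ℕ) : CouplingField := qPow ((n : ℂ) / 2) - qPow (-(n : ℂ) / 2)

/-- A complex number as a constant of the coefficient ring. -/
def const : ℂ →+* CoeffRing :=
  (PowerSeries.C : CouplingField →+* CoeffRing).comp (HahnSeries.C : ℂ →+* CouplingField)

/-- The variable `T = e^{-t}`. -/
def expNegT : CoeffRing := PowerSeries.X

/-! ### Partitions, as Young diagrams (a cell is `(row, column)`, counted from `0`) -/

theorem cells_subset_square (μ : YoungDiagram) :
    μ.cells ⊆ Finset.range μ.card ×ˢ Finset.range μ.card := by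
  intro c hc
  obtain ⟨i, j⟩ := c
  have hm : (i, j) ∈ μ := hc
  have h1 : μ.rowLen i ≤ μ.card := by
    rw [YoungDiagram.rowLen_eq_card]
    exact Finset.card_le_card (Finset.filter_subset _ _)
  have h2 : μ.colLen j ≤ μ.card := by
    rw [YoungDiagram.colLen_eq_card]
    exact Finset.card_le_card (Finset.filter_subset _ _)
  have h3 := YoungDiagram.mem_iff_lt_rowLen.mp hm
  have h4 := YoungDiagram.mem_iff_lt_colLen.mp hm
  simp only [Finset.mem_product, Finset.mem_range]
  omega

theorem cells_injective : Function.Injective YoungDiagram.cells := by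
  intro μ ν h
  exact YoungDiagram.ext h

theorem finite_card_eq (n : ℕ) : {μ : YoungDiagram | μ.card = n}.Finite := by
  refine Set.Finite.of_finite_image
    ((Finset.range n ×ˢ Finset.range n).powerset.finite_toSet.subset ?_)
    cells_injective.injOn
  rintro _ ⟨μ, rfl, rfl⟩
  exact Finset.mem_coe.mpr (Finset.mem_powerset.mpr (cells_subset_square μ))

theorem finite_le (μ : YoungDiagram) : {η : YoungDiagram | η ≤ μ}.Finite := by
  refine Set.Finite.of_finite_image
    (μ.cells.powerset.finite_toSet.subset ?_) cells_injective.injOn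
  rintro _ ⟨η, hη, rfl⟩
  simpa using hη

/-- The finite set of partitions of `n`. -/
def partitionsOf (n : ℕ) : Finset YoungDiagram := (finite_card_eq n).toFinset

/-- The finite set of partitions whose diagram is contained in that of `μ`. -/
def subpartitions (μ : YoungDiagram) : Finset YoungDiagram := (finite_le μ).toFinset

/-- The length `l(μ)`, i.e. the number of nonzero parts. -/
def len (μ : YoungDiagram) : ℕ := μ.colLen 0

/-- `κ_μ = ∑ μ_i (μ_i - 2 i + 1)`, which is twice the sum of the contents of the cells. -/
def kappa (μ : YoungDiagram) : ℤ := 2 * ∑ c ∈ μ.cells, ((c.2 : ℤ) - (c.1 : ℤ))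

/-- The exponent vector of the monomial `p_μ = ∏ p_{μ_i}`: the multiplicities of the parts. -/
def multiplicities (μ : YoungDiagram) : ℕ →₀ ℕ :=
  Multiset.toFinsupp (μ.rowLens : Multiset ℕ)

/-! ### Skew Schur functions and their specializations -/

/-- The complete symmetric functions `h_n` as a function of the values `p_k` of the power sums,
`∑ h_n z^n = exp (∑_{k ≥ 1} p_k z^k / k)`, with `h_n = 0` for `n < 0`. -/
def complete (p : ℕ → CouplingField) (n : ℤ) : CouplingField :=
  if n < 0 then 0 else
    PowerSeries.coeff n.toNat
      ((PowerSeries.exp ℚ).subst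
        (PowerSeries.mk fun k : ℕ => if k = 0 then 0 else p k / (k : CouplingField)))

/-- The skew Schur function `s_{μ/η} = det (h_{μ_i - η_j - i + j})` as a function of the values of
the power sums; it is `0` unless `η ⊆ μ`. -/
def skewSchur (p : ℕ → CouplingField) (μ η : YoungDiagram) : CouplingField :=
  open scoped Classical in
  if η ≤ μ then
    Matrix.det (Matrix.of fun i j : Fin (len μ) =>
      complete p ((μ.rowLen i : ℤ) - (η.rowLen j : ℤ) - (i : ℤ) + (j : ℤ)))
  else 0

/-- The power sums of the variables `q^{μ+ρ} = (q^{μ_i - i + 1/2})_{i ≥ 1}`.  The variables beyond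
the length of `μ` are summed by `∑_{i ≥ 1} q^{n(-i+1/2)} = 1/[n]`. In particular for `μ = ∅` these
are the power sums `1/[n]` of `q^ρ = (q^{-1/2}, q^{-3/2}, …)`. -/
def powerSumShift (μ : YoungDiagram) (n : ℕ) : CouplingField :=
  (∑ i ∈ Finset.range (len μ),
    (qPow ((n : ℂ) * ((μ.rowLen i : ℂ) - (i : ℂ) - 1 / 2)) - qPow ((n : ℂ) * (-(i : ℂ) - 1 / 2))))
    + (qNumber n)⁻¹

/-- The topological vertex
`C_{μ¹,μ²,μ³}(q) = q^{(κ_{μ²}+κ_{μ³})/2} s_{(μ²)ᵗ}(q^ρ)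
  ∑_η s_{μ¹/η}(q^{(μ²)ᵗ+ρ}) s_{(μ³)ᵗ/η}(q^{μ²+ρ})`. -/
def vertex (μ₁ μ₂ μ₃ : YoungDiagram) : CouplingField :=
  qPow (((kappa μ₂ : ℂ) + (kappa μ₃ : ℂ)) / 2) *
    skewSchur (powerSumShift ⊥) μ₂.transpose ⊥ *
    ∑ η ∈ subpartitions μ₁,
      skewSchur (powerSumShift μ₂.transpose) μ₁ η * skewSchur (powerSumShift μ₂) μ₃.transpose η

/-! ### Irreducible characters of the symmetric groups -/

/-- The symmetric group on the cells of `μ`, a copy of the symmetric group on `|μ|` letters. -/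
abbrev CellPerm (μ : YoungDiagram) : Type := Equiv.Perm {c : ℕ × ℕ // c ∈ μ.cells}

/-- The Young symmetrizer `∑ sgn(v) u v`, over `u` preserving the rows and `v` preserving the
columns of `μ`. -/
def youngSymmetrizer (μ : YoungDiagram) : MonoidAlgebra ℂ (CellPerm μ) :=
  open scoped Classical in
  (∑ u ∈ Finset.univ.filter (fun u : CellPerm μ => ∀ c, (u c).1.1 = c.1.1),
      MonoidAlgebra.single u (1 : ℂ)) *
  (∑ v ∈ Finset.univ.filter (fun v : CellPerm μ => ∀ c, (v c).1.2 = c.1.2),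
      MonoidAlgebra.single v (((Equiv.Perm.sign v : ℤ) : ℂ)))

/-- The irreducible representation `R_μ`: the left ideal generated by the Young symmetrizer. -/
abbrev specht (μ : YoungDiagram) : Ideal (MonoidAlgebra ℂ (CellPerm μ)) :=
  Ideal.span {youngSymmetrizer μ}

/-- The character of `R_μ`. -/
def spechtCharacter (μ : YoungDiagram) (g : CellPerm μ) : ℂ :=
  LinearMap.trace ℂ (specht μ)
    (Algebra.lsmul ℂ ℂ (specht μ) (MonoidAlgebra.single g (1 : ℂ)))

/-- `χ_μ(η)`: the value of the character of `R_μ` at a permutation of cycle type `η` (fixed points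
included), where `η` is given by the multiplicities of its parts; `0` if `|η| ≠ |μ|`. -/
def charValue (μ : YoungDiagram) (m : ℕ →₀ ℕ) : ℂ :=
  open scoped Classical in
  if h : ∃ g : CellPerm μ, Multiset.toFinsupp g.partition.parts = m then
    spechtCharacter μ h.choose
  else 0

/-! ### The open string amplitudes -/

/-- `|η|`, where `η` has `m i` parts equal to `i`. -/
def size (m : ℕ →₀ ℕ) : ℕ := m.sum fun i k => i * k

/-- `z_η = ∏ i^{m_i} m_i!`, where `η` has `m i` parts equal to `i`. -/
def zee (m : ℕ →₀ ℕ) : ℕ := m.prod fun i k => i ^ k * k.factorial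

/-- `∑_ν C_{μ,∅,νᵗ}(q) Q^{|ν|} C_{ν,∅,∅}(q)` with `Q = -e^{-t}`. -/
def braneAmplitude (μ : YoungDiagram) : CoeffRing :=
  PowerSeries.mk fun k =>
    ∑ ν ∈ partitionsOf k, vertex μ ⊥ ν.transpose * (-1) ^ k * vertex ν ⊥ ⊥

/-- The open string amplitude
`∑_{μ,η} q^{aκ_μ/2} (∑_ν C_{μ,∅,νᵗ} Q^{|ν|} C_{ν,∅,∅}) χ_μ(η) / (z_η √-1^{l(η)}) p_η`,
a formal power series in `p_1, p_2, …` (the variable with index `0` does not occur). -/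
def openAmplitude (a : ℤ) : MvPowerSeries ℕ CoeffRing := fun m =>
  ∑ μ ∈ partitionsOf (size m),
    PowerSeries.C (qPow ((a : ℂ) * (kappa μ : ℂ) / 2)) * braneAmplitude μ *
      const (charValue μ m / ((zee m : ℂ) * Complex.I ^ m.degree))

/-- The normalized open string amplitude: the quotient by the value at `p = 0`. -/
def normalizedAmplitude (a : ℤ) : MvPowerSeries ℕ CoeffRing :=
  MvPowerSeries.C ((MvPowerSeries.constantCoeff (openAmplitude a))⁻¹) * openAmplitude a

/-- The free energy, i.e. the logarithm of the normalized amplitude. -/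
def freeEnergy (a : ℤ) : MvPowerSeries ℕ CoeffRing :=
  (PowerSeries.log ℚ).subst (normalizedAmplitude a - 1)

/-- `F_μ = ∑_{g,k} F_{g;k;μ} λ^{2g-2+l(μ)} e^{-kt}`, the coefficient of `p_μ` in the free energy. -/
def freeEnergyCoeff (a : ℤ) (μ : YoungDiagram) : CoeffRing :=
  MvPowerSeries.coeff (multiplicities μ) (freeEnergy a)

/-- `∑_g λ^{2g-2+n} Φ_{g,n}(x_1, …, x_n)
  = ∑_{l(μ) = n} √-1^n F_μ ∑_{σ ∈ S_n} x_{σ(1)}^{μ_1} ⋯ x_{σ(n)}^{μ_n}`,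
written coefficient by coefficient. -/
def symmetrized (a : ℤ) (n : ℕ) : MvPowerSeries (Fin n) CoeffRing := fun e =>
  ∑ μ ∈ (partitionsOf e.degree).filter (fun μ => len μ = n),
    ∑ _σ ∈ (Finset.univ : Finset (Equiv.Perm (Fin n))).filter
        (fun σ => ∀ i : Fin n, e (σ i) = μ.rowLen i),
      const (Complex.I ^ n) * freeEnergyCoeff a μ

/-- `∑_g λ^{2g-2+n} Φ_{g,n}(x, …, x)`: every monomial of total degree `d` becomes `x^d`. -/
def diagonal (a : ℤ) (n : ℕ) : PowerSeries CoeffRing :=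
  PowerSeries.mk fun d =>
    ∑ e ∈ Finset.finsuppAntidiag (Finset.univ : Finset (Fin n)) d,
      MvPowerSeries.coeff e (symmetrized a n)

/-- `∑_{n ≥ 1} (1/n!) ∑_g λ^{2g-2+n} Φ_{g,n}(x, …, x)`; the `n`-th term is divisible by `x^n`, so
only `n ≤ d` contribute to the coefficient of `x^d`. -/
def logPartitionFunction (a : ℤ) : PowerSeries CoeffRing :=
  PowerSeries.mk fun d =>
    ∑ n ∈ Finset.Icc 1 d, const ((n.factorial : ℂ)⁻¹) * PowerSeries.coeff d (diagonal a n)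

/-- The partition function `Z = exp ∑_{n ≥ 1} (1/n!) ∑_g λ^{2g-2+n} Φ_{g,n}(x, …, x)`. -/
def partitionFunction (a : ℤ) : PowerSeries CoeffRing :=
  (PowerSeries.exp ℚ).subst (logPartitionFunction a)

/-! ### The operators -/

/-- The (additive) operators on formal power series in `x`. -/
abbrev Operators : Type := AddMonoid.End (PowerSeries CoeffRing)

/-- Multiplication by a power series. -/
def mulBy (f : PowerSeries CoeffRing) : Operators := AddMonoidHom.mulLeft f

/-- Multiplication by `x`. -/
def xHat : Operators := mulBy PowerSeries.X

/-- `e^{√-1 s λ x ∂/∂x}`: since `x ∂/∂x` multiplies `x^n` by `n`, this multiplies `x^n` by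
`e^{√-1 s λ n} = q^{s n}`. -/
def dilation (s : ℤ) : Operators where
  toFun f := PowerSeries.mk fun n =>
    PowerSeries.C (qPow ((s : ℂ) * (n : ℂ))) * PowerSeries.coeff n f
  map_zero' := by
    ext1 n
    simp
  map_add' f g := by
    ext1 n
    simp [mul_add]

theorem coeff_dilation (s : ℤ) (f : PowerSeries CoeffRing) (n : ℕ) :
    PowerSeries.coeff n (dilation s f) =
      PowerSeries.C (qPow ((s : ℂ) * (n : ℂ))) * PowerSeries.coeff n f :=
  PowerSeries.coeff_mk n fun n : ℕ =>
    PowerSeries.C (qPow ((s : ℂ) * (n : ℂ))) * PowerSeries.coeff n f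

theorem dilation_mul (s t : ℤ) : dilation s * dilation t = dilation (s + t) := by
  refine AddMonoidHom.ext fun f => PowerSeries.ext fun n => ?_
  have h : qPow (((s + t : ℤ) : ℂ) * (n : ℂ)) = qPow ((s : ℂ) * n) * qPow ((t : ℂ) * n) := by
    rw [← qPow_add]
    push_cast
    rw [add_mul]
  calc PowerSeries.coeff n (dilation s (dilation t f))
      = PowerSeries.C (qPow (((s + t : ℤ) : ℂ) * (n : ℂ))) * PowerSeries.coeff n f := by
        rw [coeff_dilation, coeff_dilation, h, map_mul, mul_assoc]
    _ = PowerSeries.coeff n (dilation (s + t) f) := (coeff_dilation _ _ _).symm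

theorem dilation_zero : dilation 0 = 1 := by
  refine AddMonoidHom.ext fun f => PowerSeries.ext fun n => ?_
  have h : PowerSeries.coeff n (dilation 0 f) = PowerSeries.coeff n f := by
    rw [coeff_dilation, Int.cast_zero, zero_mul, qPow_zero, map_one, one_mul]
  exact h

/-- The invertible operator `ŷ = e^{√-1 λ x ∂/∂x}`. -/
def yHat : Operatorsˣ where
  val := dilation 1
  inv := dilation (-1)
  val_inv := by rw [dilation_mul]; simpa using dilation_zero
  inv_val := by rw [dilation_mul]; simpa using dilation_zero

/-- `q^{1/2}` in the coefficient ring. -/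
def qHalf : CoeffRing := PowerSeries.C (qPow (1 / 2))

/-- The quantum mirror curve `1 - ŷ + q^{1/2} x̂ ŷ^{a+1} - q^{1/2} e^{-t} x̂ ŷ^a`. -/
def quantumCurve (a : ℤ) : Operators :=
  1 - (yHat : Operators)
    + mulBy (PowerSeries.C qHalf) * xHat * ((yHat ^ (a + 1) : Operatorsˣ) : Operators)
    - mulBy (PowerSeries.C (qHalf * expNegT)) * xHat * ((yHat ^ a : Operatorsˣ) : Operators)

end Conifold

end

/-!
The partition function is the normalized open amplitude evaluated at `p_k = √-1 x^k`: symmetrizing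
the coefficients of the free energy, restricting to the diagonal and dividing by `n!` amounts to this
substitution (`logPartitionFunction_eq`), and the exponential undoes the logarithm.

At these values of the power sums, `∑_η χ_μ(η) / z_η` is the average of the character of `R_μ`, hence
the trace of the averaging idempotent on the ideal generated by the Young symmetrizer. If `μ` has two
rows, this idempotent kills the column antisymmetrizer; if `μ = (n)`, the ideal is the trivial
representation. So only one-row partitions contribute (`coeff_specialize_openAmplitude`).

For `μ = (n)` the closed string sum is evaluated by the skew dual Cauchy identity
`∑_ν Q^{|ν|} s_{ν/(k)}(q^ρ) s_{νᵗ}(q^ρ) = e_k(q^ρ) Q^k ∑_λ Q^{|λ|} s_λ(q^ρ) s_{λᵗ}(q^ρ)`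
(`sum_skewSchur_mul`). Both Schur functions are Jacobi–Trudi determinants `det (h_{l_i - M + j})` and
`det (e_{l_i - M + j})` in the strictly decreasing sequence `l_i = ν_i + M - i`. A sum over `ν` of a
product of two antisymmetric functions is `1 / (M + 1)!` times the sum over all sequences `l`; there
the two Pieri rules, lowering and raising the `l_i` by a total of `k`, become column operations
(`sum_jacobiTrudi_sub`, `sum_jacobiTrudi_add`) and no cancellation of terms has to be tracked. The
identity `s_{νᵗ}(q^ρ) = q^{-κ_ν/2} s_ν(q^ρ)` holds because both determinants are Vandermonde
determinants, in `q^{l_i}` and in `q^{-l_i}` (`jacobiTrudi_eRho_eq`).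

Therefore `Z = ∑_n q^{a n(n-1)/2} P_n x^n` with `P_n = ∑_k h_{n-k}(q^ρ) e_k(q^ρ) (-e^{-t})^k`. The
functional equation `(1 - q^{1/2} z) H(q z) = H(z)` of `H(z) = ∑ h_n(q^ρ) z^n` gives
`(q^{n+1} - 1) P_{n+1} = q^{1/2} (q^n - e^{-t}) P_n` (`rowAmplitude_rec`), which is the quantum curve
coefficient by coefficient.
-/

noncomputable section

namespace Conifold

/-! ### Exponentials and logarithms of formal power series -/

section ExpLog

variable {R : Type*} [CommRing R] [Algebra ℚ R]

theorem exp_subst_eq (g : R⟦X⟧) (hg : PowerSeries.constantCoeff g = 0) :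
    (PowerSeries.exp ℚ).subst g = (PowerSeries.exp R).subst g := by
  have hs : PowerSeries.HasSubst g := PowerSeries.HasSubst.of_constantCoeff_zero' hg
  ext n
  rw [PowerSeries.coeff_subst' hs, PowerSeries.coeff_subst' hs]
  refine finsum_congr fun d => ?_
  simp [Algebra.smul_def]

theorem derivative_exp_subst (g : R⟦X⟧) (hg : PowerSeries.constantCoeff g = 0) :
    PowerSeries.derivative R ((PowerSeries.exp ℚ).subst g) =
      (PowerSeries.exp ℚ).subst g * PowerSeries.derivative R g := by
  rw [exp_subst_eq g hg,
    PowerSeries.derivative_subst (PowerSeries.HasSubst.of_constantCoeff_zero' hg),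
    PowerSeries.derivative_exp]

theorem constantCoeff_exp_subst (g : R⟦X⟧) (hg : PowerSeries.constantCoeff g = 0) :
    PowerSeries.constantCoeff ((PowerSeries.exp ℚ).subst g) = 1 := by
  have hs : PowerSeries.HasSubst g := PowerSeries.HasSubst.of_constantCoeff_zero' hg
  rw [← PowerSeries.coeff_zero_eq_constantCoeff_apply, PowerSeries.coeff_subst' hs,
    finsum_eq_single _ 0]
  · simp
  · intro n hn
    simp [hg, hn]

theorem exp_subst_log :
    (PowerSeries.exp ℚ).subst (PowerSeries.log ℚ) = 1 + (PowerSeries.X : ℚ⟦X⟧) := by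
  set E := (PowerSeries.exp ℚ).subst (PowerSeries.log ℚ) with hE
  have hd := derivative_exp_subst (PowerSeries.log ℚ) PowerSeries.constantCoeff_log
  rw [← hE] at hd
  have hG : PowerSeries.derivative ℚ (PowerSeries.log ℚ) * (1 + PowerSeries.X) = 1 := by
    rw [PowerSeries.deriv_log, mul_add, mul_one]
    ext n
    cases n with
    | zero => simp
    | succ n => simp [PowerSeries.coeff_succ_mul_X, PowerSeries.coeff_one, pow_succ]
  -- `E = exp (log (1 + X))` solves `(1 + X) E' = E`, which determines its coefficients.
  have hode : PowerSeries.derivative ℚ E * (1 + PowerSeries.X) = E := by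
    rw [hd, mul_assoc, hG, mul_one]
  have h0 : PowerSeries.coeff 0 E = 1 := by
    rw [PowerSeries.coeff_zero_eq_constantCoeff_apply]
    exact constantCoeff_exp_subst _ PowerSeries.constantCoeff_log
  have hrec : ∀ n : ℕ, PowerSeries.coeff (n + 1) E * (n + 1) + PowerSeries.coeff n E * n =
      PowerSeries.coeff n E := by
    intro n
    have h := congrArg (PowerSeries.coeff n) hode
    cases n with
    | zero =>
      rw [mul_add, mul_one, map_add, PowerSeries.coeff_zero_mul_X,
        PowerSeries.coeff_derivative] at h
      simpa using h
    | succ n =>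
      rw [mul_add, mul_one, map_add, PowerSeries.coeff_succ_mul_X, PowerSeries.coeff_derivative,
        PowerSeries.coeff_derivative] at h
      push_cast at h ⊢
      exact h
  have h1 : PowerSeries.coeff 1 E = 1 := by
    have := hrec 0
    simpa [h0] using this
  have h2 : ∀ n : ℕ, PowerSeries.coeff (n + 2) E = 0 := by
    intro n
    induction n with
    | zero =>
      have h := hrec 1
      rw [h1] at h
      norm_num at h
      exact h
    | succ n ih =>
      have h := hrec (n + 2)
      rw [ih] at h
      have hn : ((n : ℚ) + 2 + 1) ≠ 0 := by positivity
      push_cast at h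
      have h' : PowerSeries.coeff (n + 2 + 1) E * ((n : ℚ) + 2 + 1) = 0 := by linarith
      exact (mul_eq_zero.mp h').resolve_right hn
  ext n
  rcases n with _ | _ | n
  · simpa using h0
  · simp [h1, PowerSeries.coeff_one, PowerSeries.coeff_X]
  · rw [h2]
    simp [PowerSeries.coeff_one, PowerSeries.coeff_X]

/-- If `θ F = S F` and `θ G = S G` for the Euler operator `θ = X d/dX`, and `S` has no constant
term, then `F` and `G` agree as soon as their constant terms do. -/
theorem eq_of_euler_eq {K : Type*} [Field K] [CharZero K] {S F G : K⟦X⟧}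
    (hS : PowerSeries.constantCoeff S = 0)
    (hF : PowerSeries.X * PowerSeries.derivative K F = S * F)
    (hG : PowerSeries.X * PowerSeries.derivative K G = S * G)
    (h0 : PowerSeries.constantCoeff F = PowerSeries.constantCoeff G) : F = G := by
  rw [← sub_eq_zero]
  set D := F - G with hD
  have hode : PowerSeries.X * PowerSeries.derivative K D = S * D := by
    rw [hD, map_sub, mul_sub, hF, hG, mul_sub]
  have hD0 : PowerSeries.coeff 0 D = 0 := by
    simp [hD, h0]
  ext n
  induction n using Nat.strong_induction_on with
  | _ n ih =>
    rcases n with _ | n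
    · simpa using hD0
    have h := congrArg (PowerSeries.coeff (n + 1)) hode
    rw [PowerSeries.coeff_succ_X_mul, PowerSeries.coeff_derivative, PowerSeries.coeff_mul] at h
    have hz : ∑ p ∈ Finset.HasAntidiagonal.antidiagonal (n + 1),
        PowerSeries.coeff p.1 S * PowerSeries.coeff p.2 D = 0 := by
      refine Finset.sum_eq_zero fun p hp => ?_
      rw [Finset.HasAntidiagonal.mem_antidiagonal] at hp
      rcases Nat.eq_zero_or_pos p.1 with h1 | h1
      · rw [h1, PowerSeries.coeff_zero_eq_constantCoeff_apply, hS, zero_mul]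
      · rw [ih p.2 (by omega)]
        simp
    rw [hz] at h
    have hn : ((n : K) + 1) ≠ 0 := by exact_mod_cast Nat.succ_ne_zero n
    simpa using (mul_eq_zero.mp h).resolve_right hn

end ExpLog

/-! ### Powers of `q` -/

/-- Not an instance: it would change the `ℚ`-algebra structure found on `CouplingField`. -/
theorem charZero_couplingField : CharZero CouplingField := algebraRat.charZero CouplingField

theorem qPow_neg (s : ℂ) : qPow (-s) = (qPow s)⁻¹ := by
  refine eq_inv_of_mul_eq_one_left ?_
  rw [← qPow_add, neg_add_cancel, qPow_zero]

theorem qPow_ne_zero (s : ℂ) : qPow s ≠ 0 := by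
  intro h
  have h1 : qPow (s + -s) = 1 := by rw [add_neg_cancel, qPow_zero]
  rw [qPow_add, h, zero_mul] at h1
  exact zero_ne_one h1

theorem qPow_nat_mul (n : ℕ) (s : ℂ) : qPow (n * s) = qPow s ^ n := by
  induction n with
  | zero => simp [qPow_zero]
  | succ n ih =>
    rw [pow_succ, ← ih, ← qPow_add]
    congr 1
    push_cast
    ring

theorem qPow_ne_one {s : ℂ} (hs : s ≠ 0) : qPow s ≠ 1 := by
  intro h
  have h1 : PowerSeries.rescale (Complex.I * s) (PowerSeries.exp ℂ) = 1 := by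
    apply HahnSeries.ofPowerSeries_injective (Γ := ℤ) (R := ℂ)
    rw [map_one]
    exact h
  have h2 := congrArg (PowerSeries.coeff 1) h1
  simp [PowerSeries.coeff_rescale, PowerSeries.coeff_exp, PowerSeries.coeff_one, hs] at h2

theorem qPow_sub_one_ne_zero {n : ℕ} (hn : n ≠ 0) : qPow n - 1 ≠ 0 :=
  sub_ne_zero.mpr (qPow_ne_one (Nat.cast_ne_zero.mpr hn))

theorem qNumber_mul (n : ℕ) : qNumber n * qPow ((n : ℂ) / 2) = qPow n - 1 := by
  rw [qNumber, sub_mul, ← qPow_add, ← qPow_add]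
  congr 1
  · congr 1
    ring
  · rw [← qPow_zero]
    congr 1
    ring

theorem qNumber_ne_zero {n : ℕ} (hn : n ≠ 0) : qNumber n ≠ 0 := by
  intro h
  have h1 := qNumber_mul n
  rw [h, zero_mul] at h1
  exact qPow_sub_one_ne_zero hn h1.symm

/-! ### The complete and elementary symmetric functions at `q^ρ` -/

/-- The generating series `∑ h_n(q^ρ) z^n`. -/
def completeSeries : PowerSeries CouplingField :=
  (PowerSeries.exp ℚ).subst
    (PowerSeries.mk fun k : ℕ => if k = 0 then 0 else powerSumShift ⊥ k / (k : CouplingField))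

/-- `h_n(q^ρ)`, with `h_n = 0` for `n < 0`. -/
def hRho (n : ℤ) : CouplingField := complete (powerSumShift ⊥) n

/-- `e_n(q^ρ) = q^{-n(n-1)/2} h_n(q^ρ)`, with `e_n = 0` for `n < 0`. -/
def eRho (n : ℤ) : CouplingField := qPow (-((n : ℂ) * ((n : ℂ) - 1) / 2)) * hRho n

theorem hRho_of_neg {n : ℤ} (hn : n < 0) : hRho n = 0 := by
  simp [hRho, complete, hn]

theorem eRho_of_neg {n : ℤ} (hn : n < 0) : eRho n = 0 := by
  simp [eRho, hRho_of_neg hn]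

theorem hRho_natCast (n : ℕ) : hRho n = PowerSeries.coeff n completeSeries := by
  rw [hRho, complete, if_neg (by omega), Int.toNat_natCast, completeSeries]

theorem powerSumShift_bot (n : ℕ) : powerSumShift ⊥ n = (qNumber n)⁻¹ := by
  have h : len ⊥ = 0 := by
    rw [len, YoungDiagram.colLen_eq_card]
    simp [YoungDiagram.col]
  simp [powerSumShift, h]

theorem constantCoeff_completeSeries : PowerSeries.constantCoeff completeSeries = 1 :=
  constantCoeff_exp_subst _ (by simp [← PowerSeries.coeff_zero_eq_constantCoeff_apply])

theorem euler_completeSeries :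
    PowerSeries.X * PowerSeries.derivative CouplingField completeSeries =
      (PowerSeries.mk fun k => if k = 0 then 0 else (qNumber k)⁻¹) * completeSeries := by
  rw [completeSeries, derivative_exp_subst _
    (by simp [← PowerSeries.coeff_zero_eq_constantCoeff_apply]), mul_left_comm, mul_comm]
  congr 1
  ext n
  rcases n with _ | n
  · simp
  · have hn : ((n : CouplingField) + 1) ≠ 0 := by
      have := charZero_couplingField
      exact Nat.cast_add_one_ne_zero n
    rw [PowerSeries.coeff_succ_X_mul, PowerSeries.coeff_derivative, PowerSeries.coeff_mk,
      PowerSeries.coeff_mk, powerSumShift_bot]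
    simp only [Nat.succ_ne_zero, if_false]
    push_cast
    field_simp

theorem X_mul_derivative_rescale {K : Type*} [Field K] (c : K) (f : K⟦X⟧) :
    PowerSeries.X * PowerSeries.derivative K (PowerSeries.rescale c f) =
      PowerSeries.rescale c (PowerSeries.X * PowerSeries.derivative K f) := by
  ext n
  rcases n with _ | n
  · simp
  · rw [PowerSeries.coeff_succ_X_mul, PowerSeries.coeff_derivative, PowerSeries.coeff_rescale,
      PowerSeries.coeff_rescale, PowerSeries.coeff_succ_X_mul, PowerSeries.coeff_derivative]
    ring

/-- The functional equation `(1 - q^{1/2} z) H(q z) = H(z)` of `H(z) = ∑ h_n(q^ρ) z^n`. -/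
theorem completeSeries_functional_equation :
    (1 - PowerSeries.C (qPow (1 / 2)) * PowerSeries.X) *
      PowerSeries.rescale (qPow 1) completeSeries = completeSeries := by
  have := charZero_couplingField
  set S : PowerSeries CouplingField :=
    PowerSeries.mk fun k => if k = 0 then 0 else (qNumber k)⁻¹ with hS
  set A : PowerSeries CouplingField := 1 - PowerSeries.C (qPow (1 / 2)) * PowerSeries.X with hA
  -- `S(q z) - S(z)` is the geometric series `q^{1/2} z / (1 - q^{1/2} z)`.
  have hgeom : A * (PowerSeries.rescale (qPow 1) S - S) =
      PowerSeries.C (qPow (1 / 2)) * PowerSeries.X := by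
    have hc : PowerSeries.rescale (qPow 1) S - S =
        PowerSeries.mk fun k => if k = 0 then 0 else qPow (1 / 2) ^ k := by
      ext n
      rw [map_sub, PowerSeries.coeff_rescale, hS, PowerSeries.coeff_mk, PowerSeries.coeff_mk]
      rcases Nat.eq_zero_or_pos n with h | h
      · simp [h]
      · have h1 : n ≠ 0 := h.ne'
        simp only [h1, if_false]
        have h2 := qNumber_mul n
        rw [← qPow_nat_mul, ← qPow_nat_mul, mul_one, mul_one_div]
        have h3 := qNumber_ne_zero h1
        have h4 : qPow ((n : ℂ) / 2) = (qPow n - 1) * (qNumber n)⁻¹ := by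
          rw [← h2, mul_comm (qNumber n), mul_assoc, mul_inv_cancel₀ h3, mul_one]
        rw [h4, sub_mul, one_mul]
    rw [hc, hA, sub_mul, one_mul, mul_assoc]
    ext n
    rcases n with _ | _ | n
    · simp
    · rw [map_sub, PowerSeries.coeff_C_mul, PowerSeries.coeff_succ_X_mul]
      simp
    · rw [map_sub, PowerSeries.coeff_C_mul, PowerSeries.coeff_succ_X_mul]
      simp [pow_succ']
  refine eq_of_euler_eq (S := S) (by simp [hS, ← PowerSeries.coeff_zero_eq_constantCoeff_apply]) ?_
    euler_completeSeries ?_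
  · have h1 : PowerSeries.X * PowerSeries.derivative CouplingField A =
        -(PowerSeries.C (qPow (1 / 2)) * PowerSeries.X) := by
      rw [hA, map_sub, Derivation.leibniz]
      simp
      ring
    have h2 := X_mul_derivative_rescale (qPow 1) completeSeries
    rw [euler_completeSeries, map_mul, ← hS] at h2
    rw [Derivation.leibniz, mul_add, smul_eq_mul, smul_eq_mul, mul_left_comm, h2,
      mul_left_comm PowerSeries.X, h1]
    linear_combination (PowerSeries.rescale (qPow 1) completeSeries) * hgeom
  · rw [map_mul, hA, ← PowerSeries.coeff_zero_eq_constantCoeff_apply (PowerSeries.rescale _ _),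
      PowerSeries.coeff_rescale, PowerSeries.coeff_zero_eq_constantCoeff_apply,
      constantCoeff_completeSeries]
    simp

theorem hRho_zero : hRho 0 = 1 := by
  have h := hRho_natCast 0
  rw [PowerSeries.coeff_zero_eq_constantCoeff_apply, constantCoeff_completeSeries] at h
  exact_mod_cast h

theorem eRho_zero : eRho 0 = 1 := by
  simp [eRho, hRho_zero, qPow_zero]

theorem hRho_rec (n : ℕ) :
    (qPow ((n : ℂ) + 1) - 1) * hRho (n + 1) = qPow ((n : ℂ) + 1 / 2) * hRho n := by
  have h := congrArg (PowerSeries.coeff (n + 1)) completeSeries_functional_equation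
  rw [sub_mul, one_mul, map_sub, mul_assoc, PowerSeries.coeff_C_mul, PowerSeries.coeff_succ_X_mul,
    PowerSeries.coeff_rescale, PowerSeries.coeff_rescale, ← qPow_nat_mul, ← qPow_nat_mul,
    ← hRho_natCast, ← hRho_natCast] at h
  push_cast at h
  rw [mul_one, mul_one] at h
  rw [qPow_add n (1 / 2)]
  linear_combination h

theorem eRho_rec (n : ℕ) :
    (qPow ((n : ℂ) + 1) - 1) * eRho (n + 1) = qPow (1 / 2) * eRho n := by
  rw [eRho, eRho, mul_left_comm, hRho_rec, ← mul_assoc, ← mul_assoc, ← qPow_add, ← qPow_add]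
  congr 2
  push_cast
  ring

/-! ### Pieri rules for Jacobi–Trudi determinants -/

section JacobiTrudi

variable {R : Type*} [CommRing R] {M : ℕ}

/-- The determinant `det (h_{a_i + j})`; for `a_i = μ_i - i` this is the Jacobi–Trudi determinant
of `s_μ`. -/
def jacobiTrudi (h : ℤ → R) (a : Fin (M + 1) → ℤ) : R :=
  Matrix.det (Matrix.of fun i j : Fin (M + 1) => h (a i + (j : ℕ)))

theorem jacobiTrudi_eq_zero_of_not_injective (h : ℤ → R) {a : Fin (M + 1) → ℤ}
    (ha : ¬ Function.Injective a) : jacobiTrudi h a = 0 := by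
  simp only [Function.Injective, not_forall] at ha
  obtain ⟨i, j, hij, hne⟩ := ha
  refine Matrix.det_zero_of_row_eq hne ?_
  funext k
  simp [hij]

theorem jacobiTrudi_eq_zero_of_lt (h : ℤ → R) (hneg : ∀ n < 0, h n = 0) {a : Fin (M + 1) → ℤ}
    {i : Fin (M + 1)} (hi : a i < -(M : ℤ)) : jacobiTrudi h a = 0 := by
  refine Matrix.det_eq_zero_of_row_eq_zero i fun j => ?_
  rw [Matrix.of_apply]
  exact hneg _ (by omega)

/-- Multilinearity of the determinant in its rows, packaged as a generating function. -/
theorem coeff_det_mk (A : ℕ → Fin (M + 1) → Fin (M + 1) → R) (k : ℕ) :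
    PowerSeries.coeff k (Matrix.det (Matrix.of fun i j => PowerSeries.mk fun c => A c i j)) =
      ∑ c ∈ Finset.finsuppAntidiag Finset.univ k, Matrix.det (Matrix.of fun i j => A (c i) i j) := by
  rw [← Matrix.det_transpose, Matrix.det_apply, map_sum]
  simp_rw [← Matrix.det_transpose (Matrix.of fun i j => A _ i j)]
  simp_rw [Matrix.det_apply]
  rw [Finset.sum_comm]
  refine Finset.sum_congr rfl fun σ _ => ?_
  rw [Units.smul_def, map_zsmul, PowerSeries.coeff_prod, Finset.smul_sum]
  refine Finset.sum_congr rfl fun c _ => ?_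
  simp [Units.smul_def]

/-- Lowering the entries of `a` by a total of `k` in all possible ways amounts to lowering the
indices in the first column by `k`: this is the expansion of `s_{μ/(k)}` into Schur functions. -/
theorem sum_jacobiTrudi_sub (h : ℤ → R) (a : Fin (M + 1) → ℤ) (k : ℕ) :
    ∑ c ∈ Finset.finsuppAntidiag (Finset.univ : Finset (Fin (M + 1))) k,
        jacobiTrudi h (fun i => a i - (c i : ℕ)) =
      Matrix.det (Matrix.of fun i j : Fin (M + 1) =>
        h (a i + (j : ℕ) - if j = 0 then (k : ℤ) else 0)) := by
  have h1 := coeff_det_mk (fun c i j => h (a i - (c : ℕ) + (j : ℕ))) (M := M) k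
  unfold jacobiTrudi
  rw [← h1]
  -- Column `j` minus `X` times column `j - 1` is constant.
  rw [Matrix.det_eq_of_forall_col_eq_smul_add_pred (B := Matrix.of fun i j : Fin (M + 1) =>
      if j = 0 then PowerSeries.mk fun c : ℕ => h (a i - c) else PowerSeries.C (h (a i + (j : ℕ))))
      (fun _ => PowerSeries.X)]
  · have hm : ∀ i : Fin (M + 1), (Matrix.of fun i j : Fin (M + 1) =>
        if j = 0 then PowerSeries.mk fun c : ℕ => h (a i - c)
          else PowerSeries.C (h (a i + (j : ℕ)))).submatrix i.succAbove Fin.succ =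
        (PowerSeries.C (R := R)).mapMatrix ((Matrix.of fun i j : Fin (M + 1) =>
        h (a i + (j : ℕ) - if j = 0 then (k : ℤ) else 0)).submatrix i.succAbove Fin.succ) := by
      intro i
      ext i' j' : 2
      simp
    rw [Matrix.det_succ_column_zero, Matrix.det_succ_column_zero, map_sum]
    refine Finset.sum_congr rfl fun i _ => ?_
    rw [hm, ← RingHom.map_det, PowerSeries.coeff_mul_C]
    congr 1
    have hs : ((-1 : R⟦X⟧)) ^ (i : ℕ) = PowerSeries.C ((-1 : R) ^ (i : ℕ)) := by simp
    rw [hs, PowerSeries.coeff_C_mul]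
    simp
  · intro i
    simp
  · intro i j
    ext n
    rcases n with _ | n
    · simp
    · simp [PowerSeries.coeff_succ_X_mul]
      congr 1
      ring

/-- Raising the entries of `a` by a total of `k` in all possible ways amounts to raising the
indices in the last column by `k`. -/
theorem sum_jacobiTrudi_add (h : ℤ → R) (a : Fin (M + 1) → ℤ) (k : ℕ) :
    ∑ c ∈ Finset.finsuppAntidiag (Finset.univ : Finset (Fin (M + 1))) k,
        jacobiTrudi h (fun i => a i + (c i : ℕ)) =
      Matrix.det (Matrix.of fun i j : Fin (M + 1) =>
        h (a i + (j : ℕ) + if j = Fin.last M then (k : ℤ) else 0)) := by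
  -- Negating indices and reversing the columns turns this into the rule for lowering.
  have h1 := sum_jacobiTrudi_sub (fun n => h (-n)) (fun i => -a i - M) k
  have hsq : ((Equiv.Perm.sign (Fin.revPerm (n := M + 1)) : ℤ) : R) *
      ((Equiv.Perm.sign (Fin.revPerm (n := M + 1)) : ℤ) : R) = 1 := by
    rw [← Int.cast_mul, Int.units_coe_mul_self, Int.cast_one]
  have hl : ∀ c : Fin (M + 1) →₀ ℕ, jacobiTrudi h (fun i => a i + (c i : ℕ)) =
      ((Equiv.Perm.sign (Fin.revPerm (n := M + 1)) : ℤ) : R) *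
        jacobiTrudi (fun n => h (-n)) (fun i => (-a i - M) - (c i : ℕ)) := by
    intro c
    rw [jacobiTrudi, jacobiTrudi, ← Matrix.det_permute']
    congr 1
    ext i j
    simp only [Matrix.of_apply, Matrix.submatrix_apply, Fin.revPerm_apply, Fin.val_rev, id]
    congr 1
    omega
  simp_rw [hl]
  rw [← Finset.mul_sum, h1, ← Matrix.det_permute']
  congr 1
  ext i j
  simp only [Matrix.of_apply, Matrix.submatrix_apply, Fin.revPerm_apply, Fin.val_rev, id]
  congr 1
  have h3 : Fin.rev j = 0 ↔ j = Fin.last M := by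
    rw [Fin.rev_eq_iff, Fin.rev_zero]
  simp only [h3]
  split_ifs <;> omega

/-- The Pieri rule `∑ s_μ = h_k s_λ`, over the `μ` obtained from `λ` by adding a horizontal strip
of size `k`, in the form of a signed sum over all ways to raise the row indices.  The last row of
`λ` has to be empty for the sum over `M + 1` rows to be complete. -/
theorem sum_jacobiTrudi_add_eq_mul (h : ℤ → R) (hneg : ∀ n < 0, h n = 0) (h0 : h 0 = 1)
    {a : Fin (M + 1) → ℤ} {i : Fin (M + 1)} (hi : a i = -(M : ℤ)) (k : ℕ) :
    ∑ c ∈ Finset.finsuppAntidiag (Finset.univ : Finset (Fin (M + 1))) k,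
        jacobiTrudi h (fun i => a i + (c i : ℕ)) = h k * jacobiTrudi h a := by
  rw [sum_jacobiTrudi_add, jacobiTrudi, Matrix.det_succ_row _ i, Matrix.det_succ_row _ i,
    Finset.sum_eq_single (Fin.last M), Finset.sum_eq_single (Fin.last M)]
  · have hm : (Matrix.of fun i j : Fin (M + 1) =>
          h (a i + (j : ℕ) + if j = Fin.last M then (k : ℤ) else 0)).submatrix i.succAbove
            (Fin.last M).succAbove =
        (Matrix.of fun i j : Fin (M + 1) => h (a i + (j : ℕ))).submatrix i.succAbove
            (Fin.last M).succAbove := by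
      ext i' j'
      simp [Fin.castSucc_ne_last]
    rw [hm, Matrix.of_apply, Matrix.of_apply, hi]
    simp only [Fin.val_last, neg_add_cancel, zero_add, if_true, h0]
    ring
  · intro j _ hj
    have hj' : (j : ℕ) < M := Fin.val_lt_last hj
    rw [Matrix.of_apply, hneg _ (by omega)]
    simp
  · simp
  · intro j _ hj
    have hj' : (j : ℕ) < M := Fin.val_lt_last hj
    rw [Matrix.of_apply, if_neg hj, hneg _ (by omega)]
    simp
  · simp

/-- Adjointness of the two Pieri rules, summed over all row indices. -/
theorem sum_jacobiTrudi_mul (h e : ℤ → R) (hneg : ∀ n < 0, h n = 0) (s k : ℕ) :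
    ∑ l ∈ Finset.finsuppAntidiag (Finset.univ : Finset (Fin (M + 1))) (s + k),
        Matrix.det (Matrix.of fun i j : Fin (M + 1) =>
          h ((l i : ℤ) - M + (j : ℕ) - if j = 0 then (k : ℤ) else 0)) *
        jacobiTrudi e (fun i => (l i : ℤ) - M) =
      ∑ l ∈ Finset.finsuppAntidiag (Finset.univ : Finset (Fin (M + 1))) s,
        jacobiTrudi h (fun i => (l i : ℤ) - M) *
        ∑ c ∈ Finset.finsuppAntidiag (Finset.univ : Finset (Fin (M + 1))) k,
          jacobiTrudi e (fun i => (l i : ℤ) - M + (c i : ℕ)) := by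
  simp_rw [← sum_jacobiTrudi_sub, Finset.sum_mul, Finset.mul_sum]
  rw [← Finset.sum_product', ← Finset.sum_product',
    ← Finset.sum_filter_add_sum_filter_not _ (fun p : (Fin (M + 1) →₀ ℕ) × (Fin (M + 1) →₀ ℕ) =>
      p.2 ≤ p.1)]
  have hz : ∑ p ∈ (Finset.finsuppAntidiag (Finset.univ : Finset (Fin (M + 1))) (s + k) ×ˢ
      Finset.finsuppAntidiag (Finset.univ : Finset (Fin (M + 1))) k).filter
        (fun p => ¬ p.2 ≤ p.1), jacobiTrudi h (fun i => (p.1 i : ℤ) - M - (p.2 i : ℕ)) *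
        jacobiTrudi e (fun i => (p.1 i : ℤ) - M) = 0 := by
    refine Finset.sum_eq_zero fun p hp => ?_
    have hp2 := (Finset.mem_filter.mp hp).2
    rw [Finsupp.le_def, not_forall] at hp2
    obtain ⟨i, hi⟩ := hp2
    rw [jacobiTrudi_eq_zero_of_lt h hneg (i := i) (by omega), zero_mul]
  rw [hz, add_zero]
  refine Finset.sum_nbij' (fun p => (p.1 - p.2, p.2)) (fun p => (p.1 + p.2, p.2)) ?_ ?_ ?_ ?_ ?_
  · rintro ⟨l, c⟩ hp
    simp only [Finset.mem_filter, Finset.mem_product, Finset.mem_finsuppAntidiag,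
      Finset.subset_univ, and_true] at hp ⊢
    obtain ⟨⟨h1, h2⟩, h3⟩ := hp
    refine ⟨?_, h2⟩
    have h4 : ∑ i, ((l - c) i + c i) = ∑ i, l i :=
      Finset.sum_congr rfl fun i _ => by
        rw [Finsupp.tsub_apply]
        exact Nat.sub_add_cancel (h3 i)
    rw [Finset.sum_add_distrib] at h4
    have h1' : ∑ i, l i = s + k := h1
    have h2' : ∑ i, c i = k := h2
    change ∑ i, (l - c) i = s
    omega
  · rintro ⟨l, c⟩ hp
    simp only [Finset.mem_filter, Finset.mem_product, Finset.mem_finsuppAntidiag,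
      Finset.subset_univ, and_true] at hp ⊢
    refine ⟨⟨?_, hp.2⟩, le_add_self⟩
    have h1' : ∑ i, l i = s := hp.1
    have h2' : ∑ i, c i = k := hp.2
    change ∑ i, (l i + c i) = s + k
    rw [Finset.sum_add_distrib, h1', h2']
  · rintro ⟨l, c⟩ hp
    simp only [Finset.mem_filter] at hp
    simp [tsub_add_cancel_of_le hp.2]
  · rintro ⟨l, c⟩ hp
    simp
  · rintro ⟨l, c⟩ hp
    simp only [Finset.mem_filter] at hp
    have h5 : ∀ i, ((l - c) i : ℤ) = l i - c i := fun i => by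
      rw [Finsupp.tsub_apply, Nat.cast_sub (hp.2 i)]
    have h6 : ∀ i, (l i : ℤ) - M - c i = l i - c i - M := fun i => by ring
    have h7 : ∀ i, (l i : ℤ) - c i - M + c i = l i - M := fun i => by ring
    simp only [h5, h6, h7]

end JacobiTrudi

/-! ### Conjugation at the principal specialization -/

/-- If `g (l - r)` is `g l` times a polynomial of degree `r` in `v l` whose leading coefficient does
not depend on `l`, then column operations turn `det (g (l_i - M + j))` into a Vandermonde
determinant in the `v l_i`, up to row factors and a constant. -/
theorem jacobiTrudi_eq_vandermonde {R : Type*} [CommRing R] [Nontrivial R] {M : ℕ}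
    (g v : ℤ → R) (κ b : ℕ → R)
    (hg : ∀ (l : ℤ) (r : ℕ), g (l - (r + 1 : ℕ)) = κ r * (v l - b r) * g (l - r)) :
    ∃ K : R, ∀ l : Fin (M + 1) → ℤ, jacobiTrudi g (fun i => l i - M) =
      K * (∏ i, g (l i)) * (Matrix.vandermonde fun i => v (l i)).det := by
  have h1 : ∀ (l : ℤ) (r : ℕ), g (l - r) = g l * ((∏ s ∈ Finset.range r, κ s) *
      (∏ s ∈ Finset.range r, (Polynomial.X - Polynomial.C (b s))).eval (v l)) := by
    intro l r
    induction r with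
    | zero => simp
    | succ r ih =>
      rw [hg, ih, Finset.prod_range_succ, Finset.prod_range_succ, Polynomial.eval_mul]
      simp only [Polynomial.eval_sub, Polynomial.eval_X, Polynomial.eval_C]
      ring
  refine ⟨((Equiv.Perm.sign (Fin.revPerm (n := M + 1)) : ℤ) : R) *
    ∏ r : Fin (M + 1), ∏ s ∈ Finset.range r, κ s, fun l => ?_⟩
  rw [Matrix.det_eval_matrixOfPolynomials_eq_det_vandermonde _
    (fun r : Fin (M + 1) => ∏ s ∈ Finset.range r, (Polynomial.X - Polynomial.C (b s)))]
  · have h2 : ∀ a b c d : R, a * b * c * d = a * (c * (b * d)) := fun a b c d => by ring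
    rw [h2, ← Matrix.det_mul_row, ← Matrix.det_mul_column, ← Matrix.det_permute', jacobiTrudi]
    congr 1
    ext i j
    simp only [Matrix.of_apply, Matrix.submatrix_apply, Fin.revPerm_apply, id]
    rw [← h1, Fin.val_rev]
    congr 1
    omega
  · intro i
    rw [Polynomial.natDegree_prod_of_monic _ _ fun s _ => Polynomial.monic_X_sub_C (b s)]
    simp
  · intro i
    exact Polynomial.monic_prod_of_monic _ _ fun s _ => Polynomial.monic_X_sub_C (b s)

theorem hRho_rec_int (n : ℤ) :
    (qPow n - 1) * hRho n = qPow ((n : ℂ) - 1 / 2) * hRho (n - 1) := by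
  rcases lt_trichotomy n 0 with h | h | h
  · rw [hRho_of_neg h, hRho_of_neg (by omega), mul_zero, mul_zero]
  · subst h
    rw [hRho_of_neg (n := 0 - 1) (by omega)]
    simp [qPow_zero]
  · obtain ⟨m, rfl⟩ : ∃ m : ℕ, n = m + 1 := ⟨(n - 1).toNat, by omega⟩
    have := hRho_rec m
    push_cast
    rw [this, add_sub_cancel_right]
    congr 2
    ring

theorem eRho_rec_int (n : ℤ) :
    (qPow n - 1) * eRho n = qPow (1 / 2) * eRho (n - 1) := by
  rw [eRho, eRho, mul_left_comm, hRho_rec_int, ← mul_assoc, ← mul_assoc, ← qPow_add, ← qPow_add]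
  congr 2
  push_cast
  ring

theorem jacobiTrudi_neg_id {R : Type*} [CommRing R] {M : ℕ} (g : ℤ → R) (hneg : ∀ n < 0, g n = 0)
    (h0 : g 0 = 1) : jacobiTrudi g (fun i : Fin (M + 1) => -((i : ℕ) : ℤ)) = 1 := by
  rw [jacobiTrudi, Matrix.det_of_isUpperTriangular]
  · simp [h0]
  · intro i j hij
    have hij' : (j : ℕ) < i := hij
    rw [Matrix.of_apply]
    exact hneg _ (by omega)

theorem jacobiTrudi_eRho_hRho_exists (M : ℕ) : ∃ C : CouplingField, ∀ l : Fin (M + 1) → ℤ,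
    jacobiTrudi eRho (fun i => l i - M) =
      C * (∏ i, qPow (-((l i : ℂ) * ((l i : ℂ) - 1) / 2) + M * l i)) *
        jacobiTrudi hRho (fun i => l i - M) := by
  obtain ⟨Kh, hKh⟩ := jacobiTrudi_eq_vandermonde (M := M) hRho (fun n : ℤ => qPow (-n))
    (fun r => -qPow (1 / 2 + r)) (fun r => qPow (-r)) (by
      intro l r
      have h1 := hRho_rec_int (l - r)
      have h2 : l - (r + 1 : ℕ) = l - r - 1 := by push_cast; ring
      rw [h2]
      push_cast at h1 ⊢
      refine mul_left_cancel₀ (qPow_ne_zero ((l : ℂ) - r - 1 / 2)) ?_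
      rw [← h1, ← mul_assoc]
      congr 1
      have h3 : qPow ((l : ℂ) - r - 1 / 2) * qPow (1 / 2 + r) * qPow (-r) = qPow (l - r) := by
        rw [← qPow_add, ← qPow_add]
        congr 1
        ring
      have h4 : qPow ((l : ℂ) - r - 1 / 2) * qPow (1 / 2 + r) * qPow (-l) = 1 := by
        rw [← qPow_add, ← qPow_add, ← qPow_zero]
        congr 1
        ring
      linear_combination h4 - h3)
  obtain ⟨Ke, hKe⟩ := jacobiTrudi_eq_vandermonde (M := M) eRho (fun n : ℤ => qPow n)
    (fun r => qPow (-(1 / 2) - r)) (fun r => qPow r) (by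
      intro l r
      have h1 := eRho_rec_int (l - r)
      have h2 : l - (r + 1 : ℕ) = l - r - 1 := by push_cast; ring
      rw [h2]
      push_cast at h1 ⊢
      refine mul_left_cancel₀ (qPow_ne_zero (1 / 2)) ?_
      rw [← h1, ← mul_assoc]
      congr 1
      rw [mul_sub, mul_sub, ← qPow_add, ← qPow_add, ← qPow_add, ← qPow_add]
      congr 1
      · congr 1
        ring
      · rw [← qPow_zero]
        congr 1
        ring)
  -- The Vandermonde determinants in `q^{l_i}` and in `q^{-l_i}` agree up to sign and row factors.
  have hV : ∀ l : Fin (M + 1) → ℤ, (Matrix.vandermonde fun i => qPow (l i)).det =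
      ((Equiv.Perm.sign (Fin.revPerm (n := M + 1)) : ℤ) : CouplingField) *
        ((∏ i, qPow (M * l i)) * (Matrix.vandermonde fun i => qPow (-l i)).det) := by
    intro l
    rw [← Matrix.det_mul_column, ← Matrix.det_permute']
    congr 1
    ext i j : 2
    simp only [Matrix.of_apply, Matrix.submatrix_apply, Fin.revPerm_apply, id,
      Matrix.vandermonde_apply]
    rw [← qPow_nat_mul, ← qPow_nat_mul, ← qPow_add, Fin.val_rev]
    congr 1
    have : M + 1 - ((j : ℕ) + 1) = M - j := by omega
    rw [this, Nat.cast_sub (by omega)]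
    ring_nf
  -- For the empty partition, `l_i = M - i`, the determinant is `1`.
  have hKh0 : Kh ≠ 0 := by
    intro h
    have h1 := jacobiTrudi_neg_id (M := M) hRho (fun n => hRho_of_neg) hRho_zero
    have h2 := hKh (fun i => M - ((i : ℕ) : ℤ))
    rw [h, zero_mul, zero_mul] at h2
    have h3 : (fun i : Fin (M + 1) => (M : ℤ) - ((i : ℕ) : ℤ) - M) =
        fun i : Fin (M + 1) => -((i : ℕ) : ℤ) := by
      funext i
      ring
    rw [h3, h1] at h2
    exact one_ne_zero h2
  -- The row factors `e_l / h_l = q^{-l(l-1)/2}` combine with the factors `q^{M l}` from `hV`.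
  refine ⟨Ke * ((Equiv.Perm.sign (Fin.revPerm (n := M + 1)) : ℤ) : CouplingField) * Kh⁻¹,
    fun l => ?_⟩
  rw [hKe, hKh, hV]
  simp only [eRho, qPow_add, Finset.prod_mul_distrib]
  field_simp

/-- The conjugation formula `s_{μᵗ}(q^ρ) = q^{-κ_μ/2} s_μ(q^ρ)`: here `det (e_{μ_i - i + j})` is the
dual Jacobi–Trudi determinant of the conjugate partition. The proportionality constant is fixed by
the empty partition. -/
theorem jacobiTrudi_eRho_eq (M : ℕ) (ν : Fin (M + 1) → ℤ) :
    jacobiTrudi eRho (fun i => ν i - (i : ℕ)) =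
      qPow (-(∑ i, ((ν i : ℂ) * (ν i - 1) - 2 * (i : ℕ) * ν i)) / 2) *
        jacobiTrudi hRho (fun i => ν i - (i : ℕ)) := by
  obtain ⟨C, hC⟩ := jacobiTrudi_eRho_hRho_exists M
  have hprod : ∀ f : Fin (M + 1) → ℂ, ∏ i, qPow (f i) = qPow (∑ i, f i) := by
    intro f
    induction (Finset.univ : Finset (Fin (M + 1))) using Finset.induction_on with
    | empty => simp [qPow_zero]
    | insert i s hi ih => rw [Finset.prod_insert hi, Finset.sum_insert hi, ih, qPow_add]
  simp_rw [hprod] at hC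
  have h1 := hC (fun i => M - ((i : ℕ) : ℤ))
  have h3 : (fun i : Fin (M + 1) => (M : ℤ) - ((i : ℕ) : ℤ) - M) =
      fun i : Fin (M + 1) => -((i : ℕ) : ℤ) := by
    funext i
    ring
  rw [h3, jacobiTrudi_neg_id _ (fun n => eRho_of_neg) eRho_zero,
    jacobiTrudi_neg_id _ (fun n => hRho_of_neg) hRho_zero, mul_one] at h1
  have h2 := hC (fun i => ν i + M - ((i : ℕ) : ℤ))
  have h4 : (fun i : Fin (M + 1) => ν i + (M : ℤ) - ((i : ℕ) : ℤ) - M) =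
      fun i : Fin (M + 1) => ν i - ((i : ℕ) : ℤ) := by
    funext i
    ring
  rw [h4] at h2
  rw [h2, eq_inv_of_mul_eq_one_left h1.symm, ← qPow_neg, ← qPow_add]
  congr 2
  rw [← Finset.sum_neg_distrib, ← Finset.sum_add_distrib, neg_div, Finset.sum_div,
    ← Finset.sum_neg_distrib]
  refine Finset.sum_congr rfl fun i _ => ?_
  push_cast
  ring

/-! ### Partitions as strictly decreasing sequences -/

theorem mem_partitionsOf {n : ℕ} {μ : YoungDiagram} : μ ∈ partitionsOf n ↔ μ.card = n := by
  simp [partitionsOf]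

theorem partitionsOf_zero : partitionsOf 0 = {⊥} := by
  ext μ
  rw [mem_partitionsOf, Finset.mem_singleton]
  constructor
  · intro h
    ext1
    simpa using h
  · rintro rfl
    simp

theorem mem_subpartitions {μ η : YoungDiagram} : η ∈ subpartitions μ ↔ η ≤ μ := by
  simp [subpartitions]

theorem rowLen_eq_zero {μ : YoungDiagram} {i : ℕ} (hi : len μ ≤ i) : μ.rowLen i = 0 := by
  by_contra h
  have h1 := YoungDiagram.mem_iff_lt_rowLen.mpr (Nat.pos_of_ne_zero h)
  have h2 := YoungDiagram.mem_iff_lt_colLen.mp h1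
  rw [len] at hi
  omega

theorem rowLen_pos {μ : YoungDiagram} {i : ℕ} (hi : i < len μ) : 0 < μ.rowLen i :=
  YoungDiagram.mem_iff_lt_rowLen.mp (YoungDiagram.mem_iff_lt_colLen.mpr hi)

theorem len_le_card (μ : YoungDiagram) : len μ ≤ μ.card := by
  rw [len, YoungDiagram.colLen_eq_card]
  exact Finset.card_le_card (Finset.filter_subset _ _)

theorem ext_rowLen {μ ν : YoungDiagram} (h : ∀ i, μ.rowLen i = ν.rowLen i) : μ = ν := by
  ext ⟨i, j⟩
  rw [YoungDiagram.mem_cells, YoungDiagram.mem_cells, YoungDiagram.mem_iff_lt_rowLen,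
    YoungDiagram.mem_iff_lt_rowLen, h]

theorem le_iff_rowLen {μ ν : YoungDiagram} : μ ≤ ν ↔ ∀ i, μ.rowLen i ≤ ν.rowLen i := by
  constructor
  · intro h i
    by_contra! hlt
    have h1 : (i, ν.rowLen i) ∈ ν := h (YoungDiagram.mem_iff_lt_rowLen.mpr hlt)
    exact lt_irrefl _ (YoungDiagram.mem_iff_lt_rowLen.mp h1)
  · rintro h ⟨i, j⟩ hij
    exact YoungDiagram.mem_iff_lt_rowLen.mpr
      ((YoungDiagram.mem_iff_lt_rowLen.mp hij).trans_le (h i))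

theorem sum_cells_eq {A : Type*} [AddCommMonoid A] (f : ℕ × ℕ → A) {μ : YoungDiagram} {N : ℕ}
    (hN : len μ ≤ N) :
    ∑ c ∈ μ.cells, f c = ∑ i : Fin N, ∑ j ∈ Finset.range (μ.rowLen i), f (i, j) := by
  rw [Finset.sum_fin_eq_sum_range, ← Finset.sum_fiberwise_of_maps_to (g := Prod.fst)
    (t := Finset.range N)]
  · refine Finset.sum_congr rfl fun i hi => ?_
    rw [dif_pos (Finset.mem_range.mp hi)]
    have h := YoungDiagram.row_eq_prod (μ := μ) (i := i)
    rw [YoungDiagram.row] at h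
    rw [h, Finset.sum_product]
    simp
  · rintro ⟨i, j⟩ hc
    have h1 : i < μ.colLen j := YoungDiagram.mem_iff_lt_colLen.mp hc
    have h2 := μ.colLen_anti 0 j (Nat.zero_le j)
    rw [Finset.mem_range]
    exact (h1.trans_le h2).trans_le hN

theorem card_eq_sum_rowLen {μ : YoungDiagram} {N : ℕ} (hN : len μ ≤ N) :
    μ.card = ∑ i : Fin N, μ.rowLen i := by
  have h := sum_cells_eq (fun _ => 1) hN
  simpa using h

theorem kappa_eq {μ : YoungDiagram} {N : ℕ} (hN : len μ ≤ N) :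
    kappa μ = ∑ i : Fin N,
      ((μ.rowLen i : ℤ) * ((μ.rowLen i : ℤ) - 1) - 2 * (i : ℕ) * μ.rowLen i) := by
  rw [kappa, sum_cells_eq _ hN, Finset.mul_sum]
  refine Finset.sum_congr rfl fun i _ => ?_
  dsimp only
  induction μ.rowLen i with
  | zero => simp
  | succ n ih =>
    rw [Finset.sum_range_succ, mul_add, ih]
    push_cast
    ring

theorem kappa_transpose (μ : YoungDiagram) : kappa μ.transpose = -kappa μ := by
  rw [kappa, kappa, ← mul_neg, ← Finset.sum_neg_distrib]
  congr 1
  refine Finset.sum_nbij' Prod.swap Prod.swap ?_ ?_ ?_ ?_ ?_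
  · intro c hc
    exact YoungDiagram.mem_transpose.mp hc
  · intro c hc
    refine YoungDiagram.mem_transpose.mpr ?_
    rw [Prod.swap_swap]
    exact hc
  · simp
  · simp
  · simp

theorem exists_rowLen_eq {N : ℕ} (ν : Fin N → ℕ) (hν : Antitone ν) :
    ∃ μ : YoungDiagram, len μ ≤ N ∧ ∀ i : Fin N, μ.rowLen i = ν i := by
  have hs : (List.ofFn ν).SortedGE := List.sortedGE_ofFn_iff.mpr hν
  refine ⟨YoungDiagram.ofRowLens (List.ofFn ν) hs, ?_, fun i => ?_⟩
  · by_contra! h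
    have h1 := YoungDiagram.mem_iff_lt_colLen.mpr h
    rw [YoungDiagram.mem_ofRowLens] at h1
    obtain ⟨h2, -⟩ := h1
    simp at h2
  · have h := YoungDiagram.rowLen_ofRowLens (hw := hs) (Fin.cast (by simp) i)
    simpa using h

/-- The strictly decreasing sequence `μ_i + M - i` attached to a partition `μ` with at most `M + 1`
parts (with `i` counted from `0`). -/
def betaSeq (M : ℕ) (μ : YoungDiagram) (i : Fin (M + 1)) : ℕ := μ.rowLen i + (M - i)

theorem betaSeq_strictAnti (M : ℕ) (μ : YoungDiagram) : StrictAnti (betaSeq M μ) := by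
  intro i j hij
  have h1 := μ.rowLen_anti i j hij.le
  have h2 : (i : ℕ) < j := hij
  have h3 := j.isLt
  rw [betaSeq, betaSeq]
  omega

theorem perm_eq_one_of_strictMono {N : ℕ} {τ : Equiv.Perm (Fin N)} (h : StrictMono τ) : τ = 1 := by
  have h1 := StrictMono.range_inj h (strictMono_id (α := Fin N))
  have h2 := h1.mp (by simp [Set.range_id])
  ext i
  rw [h2]
  rfl

theorem betaSeq_comp_injective {M : ℕ} {μ ν : YoungDiagram} (hμ : len μ ≤ M + 1)
    (hν : len ν ≤ M + 1) {σ τ : Equiv.Perm (Fin (M + 1))}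
    (h : betaSeq M μ ∘ σ = betaSeq M ν ∘ τ) : σ = τ ∧ μ = ν := by
  have h1 : ∀ i, betaSeq M μ i = betaSeq M ν ((τ * σ⁻¹) i) := by
    intro i
    have := congrFun h (σ⁻¹ i)
    simpa using this
  have h2 : τ * σ⁻¹ = 1 := by
    refine perm_eq_one_of_strictMono fun i j hij => ?_
    have h3 := betaSeq_strictAnti M μ hij
    rw [h1, h1] at h3
    exact (betaSeq_strictAnti M ν).lt_iff_gt.mp h3
  refine ⟨(mul_inv_eq_one.mp h2).symm, ext_rowLen fun i => ?_⟩
  rcases lt_or_ge i (M + 1) with hi | hi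
  · have h4 := h1 ⟨i, hi⟩
    rw [h2] at h4
    simp only [betaSeq, Equiv.Perm.one_apply] at h4
    omega
  · rw [rowLen_eq_zero (hμ.trans hi), rowLen_eq_zero (hν.trans hi)]

/-- Every injective sequence arises by permuting a `betaSeq`: sort it decreasingly and subtract the
staircase `M - i`. -/
theorem exists_betaSeq_comp_eq {M : ℕ} (l : Fin (M + 1) → ℕ) (hl : Function.Injective l) :
    ∃ (σ : Equiv.Perm (Fin (M + 1))) (μ : YoungDiagram), len μ ≤ M + 1 ∧ betaSeq M μ ∘ σ = l := by
  set ρ : Equiv.Perm (Fin (M + 1)) := Fin.revPerm.trans (Tuple.sort l) with hρ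
  have hmono : StrictMono (l ∘ Tuple.sort l) :=
    (Tuple.monotone_sort l).strictMono_of_injective (hl.comp (Equiv.injective _))
  have hanti : StrictAnti (l ∘ ρ) := by
    intro i j hij
    exact hmono (Fin.rev_lt_rev.mpr hij)
  have hstep : ∀ i : ℕ, ∀ hi : i + 1 < M + 1, (l ∘ ρ) ⟨i + 1, hi⟩ < (l ∘ ρ) ⟨i, by omega⟩ :=
    fun i hi => hanti (by simp)
  have hbound : ∀ d : ℕ, ∀ hd : d < M + 1, d ≤ (l ∘ ρ) ⟨M - d, by omega⟩ := by
    intro d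
    induction d with
    | zero => exact fun _ => Nat.zero_le _
    | succ d ih =>
      intro hd
      have h1 := ih (by omega)
      have h2 := hstep (M - (d + 1)) (by omega)
      have h3 : M - (d + 1) + 1 = M - d := by omega
      simp only [h3] at h2
      omega
  have hge : ∀ i : Fin (M + 1), M - (i : ℕ) ≤ (l ∘ ρ) i := by
    intro i
    have h1 := hbound (M - i) (by omega)
    have h3 : M - (M - (i : ℕ)) = i := by omega
    simpa only [h3] using h1
  obtain ⟨μ, hμ, hrow⟩ := exists_rowLen_eq (fun i : Fin (M + 1) => (l ∘ ρ) i - (M - i)) (by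
    rw [Fin.antitone_iff_succ_le]
    intro i
    have h1 := hanti (Fin.castSucc_lt_succ (i := i))
    have h2 := i.isLt
    simp only [Fin.val_succ, Fin.val_castSucc]
    omega)
  refine ⟨ρ⁻¹, μ, hμ, ?_⟩
  funext i
  have h1 := hge (ρ⁻¹ i)
  simp only [Function.comp_apply] at h1 ⊢
  rw [betaSeq, hrow, Function.comp_apply, Nat.sub_add_cancel h1]
  simp

/-- A sum over all sequences of a symmetric function vanishing on sequences with repetitions is
`(M + 1)!` times the sum over partitions. -/
theorem sum_finsuppAntidiag_eq {K : Type*} [CommRing K] {M m : ℕ} (hm : m ≤ M)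
    (F : (Fin (M + 1) → ℕ) → K) (hsymm : ∀ l (σ : Equiv.Perm (Fin (M + 1))), F (l ∘ σ) = F l)
    (hinj : ∀ l, ¬ Function.Injective l → F l = 0) :
    ∑ l ∈ Finset.finsuppAntidiag (Finset.univ : Finset (Fin (M + 1)))
        (m + ∑ i : Fin (M + 1), (M - (i : ℕ))), F l =
      ((M + 1).factorial : K) * ∑ μ ∈ partitionsOf m, F (betaSeq M μ) := by
  classical
  have hlen : ∀ μ ∈ partitionsOf m, len μ ≤ M + 1 := fun μ hμ =>
    (len_le_card μ).trans (by rw [mem_partitionsOf.mp hμ]; omega)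
  have hR : ((M + 1).factorial : K) * ∑ μ ∈ partitionsOf m, F (betaSeq M μ) =
      ∑ p ∈ (Finset.univ : Finset (Equiv.Perm (Fin (M + 1)))) ×ˢ partitionsOf m,
        F (betaSeq M p.2 ∘ p.1) := by
    rw [Finset.sum_product]
    simp_rw [hsymm]
    rw [Finset.sum_const, Finset.card_univ, Fintype.card_perm, Fintype.card_fin, nsmul_eq_mul]
  rw [hR, ← Finset.sum_filter_of_ne (p := fun l : Fin (M + 1) →₀ ℕ => Function.Injective l)
    (fun l _ h => by_contra fun h' => h (hinj l h'))]
  symm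
  refine Finset.sum_bij (fun p _ => Finsupp.equivFunOnFinite.symm (betaSeq M p.2 ∘ p.1))
    ?_ ?_ ?_ ?_
  · rintro ⟨σ, μ⟩ hp
    have hμ := (Finset.mem_product.mp hp).2
    simp only [Finset.mem_filter, Finset.mem_finsuppAntidiag, Finset.subset_univ, and_true]
    refine ⟨?_, (betaSeq_strictAnti M μ).injective.comp σ.injective⟩
    change ∑ i, betaSeq M μ (σ i) = _
    rw [Equiv.sum_comp σ (betaSeq M μ), ← mem_partitionsOf.mp hμ,
      card_eq_sum_rowLen (hlen μ hμ), ← Finset.sum_add_distrib]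
    rfl
  · rintro ⟨σ, μ⟩ hp ⟨τ, ν⟩ hq h
    have h1 : betaSeq M μ ∘ σ = betaSeq M ν ∘ τ := Finsupp.equivFunOnFinite.symm.injective h
    obtain ⟨h2, h3⟩ := betaSeq_comp_injective (hlen μ (Finset.mem_product.mp hp).2)
      (hlen ν (Finset.mem_product.mp hq).2) h1
    rw [h2, h3]
  · intro l hl
    simp only [Finset.mem_filter, Finset.mem_finsuppAntidiag, Finset.subset_univ, and_true] at hl
    obtain ⟨hsum, hli⟩ := hl
    obtain ⟨σ, μ, hμ, h⟩ := exists_betaSeq_comp_eq l hli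
    refine ⟨(σ, μ), ?_, ?_⟩
    · rw [Finset.mem_product]
      refine ⟨Finset.mem_univ _, mem_partitionsOf.mpr ?_⟩
      have h1 : ∑ i, l i = m + ∑ i : Fin (M + 1), (M - (i : ℕ)) := hsum
      rw [← h] at h1
      simp only [Function.comp_apply] at h1
      rw [Equiv.sum_comp σ (betaSeq M μ)] at h1
      simp only [betaSeq] at h1
      rw [Finset.sum_add_distrib, ← card_eq_sum_rowLen hμ] at h1
      exact Nat.add_right_cancel h1
    · ext i
      exact congrFun h i
  · rintro ⟨σ, μ⟩ hp
    rfl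

/-! ### Skew Schur functions as determinants of larger size -/

theorem complete_of_neg (p : ℕ → CouplingField) {n : ℤ} (hn : n < 0) : complete p n = 0 := by
  rw [complete, if_pos hn]

theorem complete_zero (p : ℕ → CouplingField) : complete p 0 = 1 := by
  rw [complete, if_neg (by omega), Int.toNat_zero, PowerSeries.coeff_zero_eq_constantCoeff_apply]
  exact constantCoeff_exp_subst _ (by simp [← PowerSeries.coeff_zero_eq_constantCoeff_apply])

theorem det_eq_det_castSucc {R : Type*} [CommRing R] {N : ℕ}
    (A : Matrix (Fin (N + 1)) (Fin (N + 1)) R) (h1 : A (Fin.last N) (Fin.last N) = 1)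
    (h0 : ∀ j, j ≠ Fin.last N → A (Fin.last N) j = 0) :
    A.det = (A.submatrix Fin.castSucc Fin.castSucc).det := by
  rw [Matrix.det_succ_row _ (Fin.last N), Finset.sum_eq_single (Fin.last N)]
  · rw [h1, Even.neg_one_pow ⟨_, rfl⟩, one_mul, one_mul, Fin.succAbove_last]
  · intro j _ hj
    rw [h0 j hj, mul_zero, zero_mul]
  · simp

theorem skewSchur_eq_det (p : ℕ → CouplingField) {μ η : YoungDiagram} (hη : η ≤ μ) {N : ℕ}
    (hN : len μ ≤ N) :
    skewSchur p μ η = Matrix.det (Matrix.of fun i j : Fin N =>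
      complete p ((μ.rowLen i : ℤ) - (i : ℕ) + (j : ℕ) - (η.rowLen j : ℤ))) := by
  induction N, hN using Nat.le_induction with
  | base =>
    rw [skewSchur, if_pos hη]
    congr 1
    ext i j : 2
    rw [Matrix.of_apply, Matrix.of_apply]
    congr 1
    ring_nf
  | succ N hN ih =>
    have h0 : η.rowLen N = 0 :=
      Nat.le_zero.mp ((le_iff_rowLen.mp hη N).trans_eq (rowLen_eq_zero hN))
    rw [ih, det_eq_det_castSucc]
    · congr 1
    · rw [Matrix.of_apply, Fin.val_last, rowLen_eq_zero hN, h0]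
      simpa using complete_zero p
    · intro j hj
      have hj' : (j : ℕ) < N := Fin.val_lt_last hj
      rw [Matrix.of_apply, Fin.val_last, rowLen_eq_zero hN]
      exact complete_of_neg p (by omega)

/-! ### The closed string sum with a one-row partition on the brane -/

/-- The partition `(n)`. -/
def rowDiagram (n : ℕ) : YoungDiagram where
  cells := {0} ×ˢ Finset.range n
  isLowerSet := by
    rintro ⟨i, j⟩ ⟨i', j'⟩ h hc
    obtain ⟨h1, h2⟩ := Prod.mk_le_mk.mp h
    simp only [Finset.coe_product, Finset.coe_singleton, Finset.coe_range, Set.mem_prod,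
      Set.mem_singleton_iff, Set.mem_Iio] at hc ⊢
    omega

theorem mem_rowDiagram {n i j : ℕ} : (i, j) ∈ rowDiagram n ↔ i = 0 ∧ j < n := by
  rw [← YoungDiagram.mem_cells]
  simp only [rowDiagram, Finset.mem_product, Finset.mem_singleton, Finset.mem_range]

theorem rowLen_rowDiagram (n i : ℕ) : (rowDiagram n).rowLen i = if i = 0 then n else 0 := by
  refine eq_of_forall_lt_iff fun j => ?_
  rw [← YoungDiagram.mem_iff_lt_rowLen, mem_rowDiagram]
  split_ifs with h <;> simp [h]

theorem card_rowDiagram (n : ℕ) : (rowDiagram n).card = n := by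
  simp [YoungDiagram.card, rowDiagram]

theorem rowDiagram_injective : Function.Injective rowDiagram := by
  intro m n h
  rw [← card_rowDiagram m, h, card_rowDiagram]

theorem rowDiagram_zero : rowDiagram 0 = ⊥ := by
  ext1
  simp [rowDiagram]

theorem rowDiagram_le_iff {n : ℕ} {μ : YoungDiagram} : rowDiagram n ≤ μ ↔ n ≤ μ.rowLen 0 := by
  rw [le_iff_rowLen]
  constructor
  · intro h
    simpa [rowLen_rowDiagram] using h 0
  · intro h i
    rw [rowLen_rowDiagram]
    split_ifs with hi
    · rwa [hi]
    · exact Nat.zero_le _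

theorem le_rowDiagram_iff {n : ℕ} {η : YoungDiagram} :
    η ≤ rowDiagram n ↔ ∃ k ≤ n, rowDiagram k = η := by
  constructor
  · intro h
    rw [le_iff_rowLen] at h
    refine ⟨η.rowLen 0, by simpa [rowLen_rowDiagram] using h 0, ext_rowLen fun i => ?_⟩
    have hi := h i
    rw [rowLen_rowDiagram] at hi ⊢
    split_ifs at hi ⊢ with h0
    · rw [h0]
    · omega
  · rintro ⟨k, hk, rfl⟩
    rw [rowDiagram_le_iff, rowLen_rowDiagram]
    simpa using hk

theorem len_rowDiagram_le (n : ℕ) : len (rowDiagram n) ≤ 1 := by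
  by_contra! h
  have h1 := rowLen_pos h
  rw [rowLen_rowDiagram] at h1
  simp at h1

theorem kappa_rowDiagram (n : ℕ) : kappa (rowDiagram n) = (n : ℤ) * ((n : ℤ) - 1) := by
  rw [kappa_eq (len_rowDiagram_le n)]
  simp [rowLen_rowDiagram]

/-- The skew Schur function `s_{ν/(k)}(q^ρ)` as a determinant of size at least the length of `ν`;
it vanishes when `(k)` is not contained in `ν`. -/
theorem skewSchur_rowDiagram (ν : YoungDiagram) (k : ℕ) {M : ℕ} (hM : len ν ≤ M + 1) :
    skewSchur (powerSumShift ⊥) ν (rowDiagram k) = Matrix.det (Matrix.of fun i j : Fin (M + 1) =>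
      hRho ((ν.rowLen i : ℤ) - (i : ℕ) + (j : ℕ) - if j = 0 then (k : ℤ) else 0)) := by
  by_cases hk : rowDiagram k ≤ ν
  · rw [skewSchur_eq_det _ hk hM]
    congr 1
    ext i j : 2
    rw [Matrix.of_apply, Matrix.of_apply, hRho, rowLen_rowDiagram]
    congr 2
    by_cases hj : j = 0
    · simp [hj]
    · have hj' : (j : ℕ) ≠ 0 := fun h => hj (Fin.ext h)
      simp [hj, hj']
  · rw [skewSchur, if_neg hk]
    symm
    refine Matrix.det_eq_zero_of_column_eq_zero 0 fun i => ?_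
    rw [rowDiagram_le_iff, not_le] at hk
    have h1 := ν.rowLen_anti 0 i (Nat.zero_le _)
    rw [Matrix.of_apply, if_pos rfl]
    exact hRho_of_neg (by simp only [Fin.val_zero]; omega)

theorem skewSchur_bot (ν : YoungDiagram) {M : ℕ} (hM : len ν ≤ M + 1) :
    skewSchur (powerSumShift ⊥) ν ⊥ =
      jacobiTrudi hRho (fun i : Fin (M + 1) => (ν.rowLen i : ℤ) - (i : ℕ)) := by
  have h := skewSchur_rowDiagram ν 0 hM
  rw [rowDiagram_zero] at h
  rw [h, jacobiTrudi]
  simp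

theorem qPow_mul_skewSchur_bot (ν : YoungDiagram) {M : ℕ} (hM : len ν ≤ M + 1) :
    qPow (-(kappa ν : ℂ) / 2) * skewSchur (powerSumShift ⊥) ν ⊥ =
      jacobiTrudi eRho (fun i : Fin (M + 1) => (ν.rowLen i : ℤ) - (i : ℕ)) := by
  rw [jacobiTrudi_eRho_eq, skewSchur_bot ν hM, kappa_eq hM]
  push_cast
  rfl

theorem betaSeq_sub (M : ℕ) (ν : YoungDiagram) (i : Fin (M + 1)) :
    (betaSeq M ν i : ℤ) - M = (ν.rowLen i : ℤ) - (i : ℕ) := by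
  have := i.isLt
  rw [betaSeq]
  omega

/-- The product of two functions antisymmetric in `l` is symmetric in `l`. -/
theorem det_comp_perm_mul {R ι : Type*} [CommRing R] {N : ℕ} (f g : ι → Fin N → R) (l : Fin N → ι)
    (σ : Equiv.Perm (Fin N)) :
    Matrix.det (Matrix.of fun i j => f (l (σ i)) j) *
        Matrix.det (Matrix.of fun i j => g (l (σ i)) j) =
      Matrix.det (Matrix.of fun i j => f (l i) j) * Matrix.det (Matrix.of fun i j => g (l i) j) := by
  have h1 := Matrix.det_permute σ (Matrix.of fun i j => f (l i) j)
  have h2 := Matrix.det_permute σ (Matrix.of fun i j => g (l i) j)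
  have h3 : ((Equiv.Perm.sign σ : ℤ) : R) * ((Equiv.Perm.sign σ : ℤ) : R) = 1 := by
    rw [← Int.cast_mul, Int.units_coe_mul_self, Int.cast_one]
  change Matrix.det (Matrix.submatrix (Matrix.of fun i j => f (l i) j) σ id) *
    Matrix.det (Matrix.submatrix (Matrix.of fun i j => g (l i) j) σ id) = _
  rw [h1, h2]
  linear_combination (Matrix.det (Matrix.of fun i j => f (l i) j) *
    Matrix.det (Matrix.of fun i j => g (l i) j)) * h3

/-- The skew dual Cauchy identity
`∑_ν s_{ν/(k)}(q^ρ) s_{νᵗ}(q^ρ) = e_k(q^ρ) ∑_λ s_λ(q^ρ) s_{λᵗ}(q^ρ)`, in each degree. -/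
theorem sum_skewSchur_mul (s k : ℕ) :
    ∑ ν ∈ partitionsOf (s + k), skewSchur (powerSumShift ⊥) ν (rowDiagram k) *
        (qPow (-(kappa ν : ℂ) / 2) * skewSchur (powerSumShift ⊥) ν ⊥) =
      eRho k * ∑ ν ∈ partitionsOf s, skewSchur (powerSumShift ⊥) ν ⊥ *
        (qPow (-(kappa ν : ℂ) / 2) * skewSchur (powerSumShift ⊥) ν ⊥) := by
  -- With `M + 1 > s + k` rows all partitions that occur fit, and the last row of `λ` is empty.
  set M := s + k with hM
  have hlen : ∀ ν ∈ partitionsOf M, len ν ≤ M + 1 := fun ν hν =>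
    (len_le_card ν).trans (by rw [mem_partitionsOf.mp hν]; omega)
  have hlen' : ∀ ν ∈ partitionsOf s, len ν ≤ M := fun ν hν =>
    (len_le_card ν).trans (by rw [mem_partitionsOf.mp hν]; omega)
  have hfac : ((M + 1).factorial : CouplingField) ≠ 0 := by
    have := charZero_couplingField
    exact_mod_cast (M + 1).factorial_ne_zero
  have hzero : ∀ (g : ℤ → CouplingField) (l : Fin (M + 1) → ℕ), ¬ Function.Injective l →
      jacobiTrudi g (fun i => (l i : ℤ) - M) = 0 := by
    intro g l hl
    refine jacobiTrudi_eq_zero_of_not_injective g fun h => hl fun i j hij => h ?_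
    simp only [hij]
  have hcauchy := sum_jacobiTrudi_mul (M := M) hRho eRho (fun n => hRho_of_neg)
    (s + ∑ i : Fin (M + 1), (M - (i : ℕ))) k
  simp_rw [sum_jacobiTrudi_add] at hcauchy
  have hdeg : s + ∑ i : Fin (M + 1), (M - (i : ℕ)) + k = M + ∑ i : Fin (M + 1), (M - (i : ℕ)) := by
    omega
  rw [hdeg,
    sum_finsuppAntidiag_eq le_rfl
      (fun l => Matrix.det (Matrix.of fun i j : Fin (M + 1) =>
          hRho ((l i : ℤ) - M + (j : ℕ) - if j = 0 then (k : ℤ) else 0)) *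
        jacobiTrudi eRho (fun i => (l i : ℤ) - M))
      (fun l σ => det_comp_perm_mul
        (fun (x : ℕ) (j : Fin (M + 1)) => hRho ((x : ℤ) - M + (j : ℕ) - if j = 0 then (k : ℤ) else 0))
        (fun (x : ℕ) j => eRho ((x : ℤ) - M + (j : ℕ))) l σ)
      (fun l hl => by rw [hzero eRho l hl, mul_zero]),
    sum_finsuppAntidiag_eq (by omega)
      (fun l => jacobiTrudi hRho (fun i => (l i : ℤ) - M) *
        Matrix.det (Matrix.of fun i j : Fin (M + 1) =>
          eRho ((l i : ℤ) - M + (j : ℕ) + if j = Fin.last M then (k : ℤ) else 0)))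
      (fun l σ => det_comp_perm_mul
        (fun (x : ℕ) j => hRho ((x : ℤ) - M + (j : ℕ)))
        (fun (x : ℕ) (j : Fin (M + 1)) =>
          eRho ((x : ℤ) - M + (j : ℕ) + if j = Fin.last M then (k : ℤ) else 0)) l σ)
      (fun l hl => by rw [hzero hRho l hl, zero_mul])] at hcauchy
  have h := mul_left_cancel₀ hfac hcauchy
  simp only [betaSeq_sub] at h
  rw [Finset.mul_sum]
  refine Eq.trans ?_ (h.trans ?_)
  · refine Finset.sum_congr rfl fun ν hν => ?_
    rw [skewSchur_rowDiagram ν k (hlen ν hν), qPow_mul_skewSchur_bot ν (hlen ν hν)]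
  · refine Finset.sum_congr rfl fun ν hν => ?_
    have hν' : len ν ≤ M + 1 := (hlen' ν hν).trans (Nat.le_succ M)
    rw [qPow_mul_skewSchur_bot ν hν', skewSchur_bot ν hν', ← sum_jacobiTrudi_add,
      sum_jacobiTrudi_add_eq_mul eRho (fun n => eRho_of_neg) eRho_zero (i := Fin.last M)]
    · ring
    · rw [Fin.val_last, rowLen_eq_zero (hlen' ν hν)]
      simp

theorem bot_mem_subpartitions (μ : YoungDiagram) : ⊥ ∈ subpartitions μ :=
  mem_subpartitions.mpr bot_le

theorem transpose_bot : (⊥ : YoungDiagram).transpose = ⊥ := by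
  ext1
  simp [YoungDiagram.transpose]

theorem kappa_bot : kappa ⊥ = 0 := by
  simp [kappa]

theorem skewSchur_bot_bot (p : ℕ → CouplingField) : skewSchur p ⊥ ⊥ = 1 := by
  rw [skewSchur_eq_det p le_rfl (N := 0) ((len_le_card _).trans (by simp))]
  simp

theorem vertex_bot_bot (ν : YoungDiagram) :
    vertex ν ⊥ ⊥ = skewSchur (powerSumShift ⊥) ν ⊥ := by
  rw [vertex, transpose_bot, kappa_bot, skewSchur_bot_bot, Finset.sum_eq_single ⊥]
  · simp [skewSchur_bot_bot, qPow_zero]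
  · intro η _ hη
    have h : ¬ η ≤ ⊥ := fun h => hη (le_bot_iff.mp h)
    rw [skewSchur.eq_def _ ⊥, if_neg h, mul_zero]
  · intro h
    exact absurd (bot_mem_subpartitions ν) h

theorem subpartitions_rowDiagram (n : ℕ) :
    subpartitions (rowDiagram n) = (Finset.range (n + 1)).map ⟨rowDiagram, rowDiagram_injective⟩ := by
  ext η
  rw [mem_subpartitions, le_rowDiagram_iff]
  simp

theorem skewSchur_rowDiagram_rowDiagram {n k : ℕ} (hk : k ≤ n) :
    skewSchur (powerSumShift ⊥) (rowDiagram n) (rowDiagram k) = hRho ((n - k : ℕ) : ℤ) := by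
  rw [skewSchur_rowDiagram (M := 0) _ _ (len_rowDiagram_le n)]
  simp [rowLen_rowDiagram, Nat.cast_sub hk]

theorem vertex_rowDiagram (n : ℕ) (ν : YoungDiagram) :
    vertex (rowDiagram n) ⊥ ν.transpose = qPow (-(kappa ν : ℂ) / 2) *
      ∑ k ∈ Finset.range (n + 1), hRho ((n - k : ℕ) : ℤ) *
        skewSchur (powerSumShift ⊥) ν (rowDiagram k) := by
  rw [vertex, transpose_bot, kappa_bot, skewSchur_bot_bot, mul_one, kappa_transpose,
    YoungDiagram.transpose_transpose, subpartitions_rowDiagram, Finset.sum_map]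
  congr 1
  · congr 1
    push_cast
    ring
  · refine Finset.sum_congr rfl fun k hk => ?_
    rw [Function.Embedding.coeFn_mk,
      skewSchur_rowDiagram_rowDiagram (Nat.lt_succ_iff.mp (Finset.mem_range.mp hk))]

/-- `∑_k h_{n-k}(q^ρ) e_k(q^ρ) Q^k` with `Q = -e^{-t}`: the amplitude of the one-row partition `(n)`
relative to the closed string amplitude. -/
def rowAmplitude (n : ℕ) : CoeffRing :=
  ∑ k ∈ Finset.range (n + 1),
    PowerSeries.C (hRho ((n - k : ℕ) : ℤ)) * PowerSeries.C (eRho k) * (-expNegT) ^ k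

theorem neg_expNegT_pow (k : ℕ) :
    (-expNegT) ^ k = PowerSeries.C ((-1 : CouplingField) ^ k) * PowerSeries.X ^ k := by
  have h : ∀ {R : Type} [CommRing R], (-(PowerSeries.X : R⟦X⟧)) ^ k =
      PowerSeries.C ((-1 : R) ^ k) * PowerSeries.X ^ k := by
    intro R _
    rw [neg_pow]
    simp
  exact h (R := CouplingField)

theorem coeff_braneAmplitude_bot (k : ℕ) :
    PowerSeries.coeff k (braneAmplitude ⊥) = (-1) ^ k *
      ∑ ν ∈ partitionsOf k, skewSchur (powerSumShift ⊥) ν ⊥ *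
        (qPow (-(kappa ν : ℂ) / 2) * skewSchur (powerSumShift ⊥) ν ⊥) := by
  rw [braneAmplitude, PowerSeries.coeff_mk, Finset.mul_sum]
  refine Finset.sum_congr rfl fun ν _ => ?_
  have h := vertex_rowDiagram 0 ν
  rw [rowDiagram_zero] at h
  rw [h, vertex_bot_bot]
  simp only [zero_add, Finset.range_one, Finset.sum_singleton, Nat.sub_zero, Nat.cast_zero,
    hRho_zero, rowDiagram_zero]
  ring

theorem braneAmplitude_rowDiagram (n : ℕ) :
    braneAmplitude (rowDiagram n) = rowAmplitude n * braneAmplitude ⊥ := by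
  refine PowerSeries.ext fun m => ?_
  rw [rowAmplitude, Finset.sum_mul, map_sum, braneAmplitude, PowerSeries.coeff_mk]
  have h1 : ∀ ν : YoungDiagram, vertex (rowDiagram n) ⊥ ν.transpose * (-1) ^ m * vertex ν ⊥ ⊥ =
      ∑ k ∈ Finset.range (n + 1), (-1) ^ m * hRho ((n - k : ℕ) : ℤ) *
        (skewSchur (powerSumShift ⊥) ν (rowDiagram k) *
          (qPow (-(kappa ν : ℂ) / 2) * skewSchur (powerSumShift ⊥) ν ⊥)) := by
    intro ν
    rw [vertex_rowDiagram, vertex_bot_bot, Finset.mul_sum, Finset.sum_mul, Finset.sum_mul]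
    refine Finset.sum_congr rfl fun k _ => ?_
    ring
  simp_rw [h1]
  rw [Finset.sum_comm]
  refine Finset.sum_congr rfl fun k _ => ?_
  rw [← Finset.mul_sum, neg_expNegT_pow]
  have h2 : PowerSeries.C (hRho ((n - k : ℕ) : ℤ)) * PowerSeries.C (eRho k) *
      (PowerSeries.C ((-1 : CouplingField) ^ k) * PowerSeries.X ^ k) * braneAmplitude ⊥ =
      PowerSeries.C (hRho ((n - k : ℕ) : ℤ) * eRho k * (-1) ^ k) *
        (PowerSeries.X ^ k * braneAmplitude ⊥) := by
    rw [map_mul, map_mul]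
    ring
  rw [h2, PowerSeries.coeff_C_mul, PowerSeries.coeff_X_pow_mul']
  split_ifs with hk
  · obtain ⟨s, rfl⟩ := Nat.exists_eq_add_of_le' hk
    rw [sum_skewSchur_mul, Nat.add_sub_cancel, coeff_braneAmplitude_bot]
    ring
  · rw [mul_zero, Finset.sum_eq_zero, mul_zero]
    intro ν hν
    have h3 : ¬ rowDiagram k ≤ ν := by
      intro h
      have h4 := Finset.card_le_card (YoungDiagram.cells_subset_iff.mpr h)
      have h5 : k ≤ m := by
        rw [← card_rowDiagram k, ← mem_partitionsOf.mp hν]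
        exact h4
      exact hk h5
    rw [skewSchur, if_neg h3, zero_mul]

theorem constantCoeff_braneAmplitude_bot :
    PowerSeries.constantCoeff (braneAmplitude ⊥) = 1 := by
  rw [← PowerSeries.coeff_zero_eq_constantCoeff_apply, coeff_braneAmplitude_bot, partitionsOf_zero]
  simp [skewSchur_bot_bot, kappa_bot, qPow_zero]

/-- If `(q^{n+1} - 1) h_{n+1} = c q^n h_n` and `(q^{n+1} - 1) e_{n+1} = c e_n`, then the convolution
`P_n = ∑ h_{n-k} e_k u^k` satisfies `(q^{n+1} - 1) P_{n+1} = c (q^n + u) P_n`. -/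
theorem convolution_rec {A : Type*} [CommRing A] (q c u : A) (h e : ℕ → A)
    (hh : ∀ n, (q ^ (n + 1) - 1) * h (n + 1) = c * q ^ n * h n)
    (he : ∀ n, (q ^ (n + 1) - 1) * e (n + 1) = c * e n) (n : ℕ) :
    (q ^ (n + 1) - 1) * ∑ k ∈ Finset.range (n + 1 + 1), h (n + 1 - k) * e k * u ^ k =
      c * (q ^ n + u) * ∑ k ∈ Finset.range (n + 1), h (n - k) * e k * u ^ k := by
  -- Split `q^{n+1} - 1 = q^k (q^{n+1-k} - 1) + (q^k - 1)` in the `k`-th term.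
  have h1 : ∑ k ∈ Finset.range (n + 1 + 1),
      q ^ k * (q ^ (n + 1 - k) - 1) * (h (n + 1 - k) * e k * u ^ k) =
      c * q ^ n * ∑ k ∈ Finset.range (n + 1), h (n - k) * e k * u ^ k := by
    rw [Finset.sum_range_succ, Nat.sub_self, pow_zero, sub_self, mul_zero, zero_mul, add_zero,
      Finset.mul_sum]
    refine Finset.sum_congr rfl fun k hk => ?_
    obtain ⟨d, rfl⟩ := Nat.exists_eq_add_of_le' (Nat.lt_succ_iff.mp (Finset.mem_range.mp hk))
    rw [Nat.add_right_comm, Nat.add_sub_cancel, Nat.add_sub_cancel]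
    linear_combination q ^ k * e k * u ^ k * hh d
  have h2 : ∑ k ∈ Finset.range (n + 1 + 1), (q ^ k - 1) * (h (n + 1 - k) * e k * u ^ k) =
      c * u * ∑ k ∈ Finset.range (n + 1), h (n - k) * e k * u ^ k := by
    rw [Finset.sum_range_succ', pow_zero, sub_self, zero_mul, add_zero, Finset.mul_sum]
    refine Finset.sum_congr rfl fun k _ => ?_
    rw [Nat.add_sub_add_right]
    linear_combination h (n - k) * u ^ (k + 1) * he k
  rw [mul_add c, add_mul, ← h1, ← h2, ← Finset.sum_add_distrib, Finset.mul_sum]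
  refine Finset.sum_congr rfl fun k hk => ?_
  obtain ⟨d, hd⟩ := Nat.exists_eq_add_of_le' (Nat.lt_succ_iff.mp (Finset.mem_range.mp hk))
  rw [hd, Nat.add_sub_cancel]
  ring

theorem rowAmplitude_rec (n : ℕ) :
    (PowerSeries.C (qPow 1) ^ (n + 1) - 1) * rowAmplitude (n + 1) =
      qHalf * (PowerSeries.C (qPow 1) ^ n - expNegT) * rowAmplitude n := by
  rw [sub_eq_add_neg _ expNegT]
  refine convolution_rec _ _ _ (fun n => PowerSeries.C (hRho n)) (fun n => PowerSeries.C (eRho n))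
    ?_ ?_ n
  · intro n
    have h := hRho_rec n
    rw [qHalf, ← map_pow, ← map_pow, ← qPow_nat_mul, ← qPow_nat_mul, ← map_mul, ← map_mul,
      ← qPow_add, ← map_one (PowerSeries.C : CouplingField →+* CoeffRing), ← map_sub, ← map_mul]
    congr 1
    push_cast
    rw [mul_one, mul_one, h]
    congr 2
    ring
  · intro n
    have h := eRho_rec n
    rw [qHalf, ← map_pow, ← qPow_nat_mul, ← map_mul,
      ← map_one (PowerSeries.C : CouplingField →+* CoeffRing), ← map_sub, ← map_mul]
    congr 1
    push_cast
    rw [mul_one, h]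

/-! ### Averages of the irreducible characters -/

section Averaging

variable {G : Type*} [Group G] [Fintype G]

/-- The sum of all elements of a finite group. -/
def groupSum (G : Type*) [Group G] [Fintype G] : MonoidAlgebra ℂ G :=
  ∑ g : G, MonoidAlgebra.single g (1 : ℂ)

theorem single_mul_groupSum (g : G) (r : ℂ) :
    MonoidAlgebra.single g r * groupSum G = r • groupSum G := by
  rw [groupSum, Finset.mul_sum, Finset.smul_sum]
  simp_rw [MonoidAlgebra.single_mul_single, MonoidAlgebra.smul_single]
  exact (Equiv.sum_comp (Equiv.mulLeft g) fun h : G => MonoidAlgebra.single h (r * 1))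

theorem groupSum_mul_single (g : G) (r : ℂ) :
    groupSum G * MonoidAlgebra.single g r = r • groupSum G := by
  rw [groupSum, Finset.sum_mul, Finset.smul_sum]
  simp_rw [MonoidAlgebra.single_mul_single, MonoidAlgebra.smul_single, smul_eq_mul, mul_comm r]
  exact (Equiv.sum_comp (Equiv.mulRight g) fun h : G => MonoidAlgebra.single h (1 * r))

theorem exists_mul_groupSum (x : MonoidAlgebra ℂ G) : ∃ c : ℂ, x * groupSum G = c • groupSum G := by
  induction x using MonoidAlgebra.induction_linear with
  | zero => exact ⟨0, by simp⟩
  | add x y hx hy =>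
    obtain ⟨c, hc⟩ := hx
    obtain ⟨d, hd⟩ := hy
    exact ⟨c + d, by rw [add_mul, hc, hd, add_smul]⟩
  | single g r => exact ⟨r, single_mul_groupSum g r⟩

theorem exists_groupSum_mul (x : MonoidAlgebra ℂ G) : ∃ c : ℂ, groupSum G * x = c • groupSum G := by
  induction x using MonoidAlgebra.induction_linear with
  | zero => exact ⟨0, by simp⟩
  | add x y hx hy =>
    obtain ⟨c, hc⟩ := hx
    obtain ⟨d, hd⟩ := hy
    exact ⟨c + d, by rw [mul_add, hc, hd, add_smul]⟩
  | single g r => exact ⟨r, groupSum_mul_single g r⟩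

theorem groupSum_ne_zero : groupSum G ≠ 0 := by
  classical
  intro h
  have h1 := congrArg (fun x : MonoidAlgebra ℂ G => x.coeff 1) h
  simp [groupSum, MonoidAlgebra.coeff_sum, MonoidAlgebra.coeff_single, Finsupp.single_apply] at h1

end Averaging

theorem spechtCharacter_conj (μ : YoungDiagram) {g h : CellPerm μ} (hgh : IsConj g h) :
    spechtCharacter μ g = spechtCharacter μ h := by
  obtain ⟨t, rfl⟩ := isConj_iff.mp hgh
  have h1 : MonoidAlgebra.single (t * g * t⁻¹) (1 : ℂ) = MonoidAlgebra.single t (1 : ℂ) *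
      MonoidAlgebra.single g (1 : ℂ) * MonoidAlgebra.single t⁻¹ (1 : ℂ) := by
    simp [MonoidAlgebra.single_mul_single]
  have h2 : MonoidAlgebra.single t⁻¹ (1 : ℂ) * (MonoidAlgebra.single t (1 : ℂ) *
      MonoidAlgebra.single g (1 : ℂ)) = MonoidAlgebra.single g (1 : ℂ) := by
    simp [MonoidAlgebra.single_mul_single]
  rw [spechtCharacter, spechtCharacter, h1, map_mul, LinearMap.trace_mul_comm, ← map_mul, h2]

theorem sum_spechtCharacter (μ : YoungDiagram) : ∑ g, spechtCharacter μ g =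
    LinearMap.trace ℂ (specht μ) (Algebra.lsmul ℂ ℂ (specht μ) (groupSum (CellPerm μ))) := by
  rw [groupSum, map_sum, map_sum]
  rfl

/-- If some column of `μ` has two cells, then the symmetrizing element kills the Young
symmetrizer. -/
theorem groupSum_mul_youngSymmetrizer {μ : YoungDiagram} (hμ : 1 < len μ) :
    groupSum (CellPerm μ) * youngSymmetrizer μ = 0 := by
  classical
  have hc0 : ((0 : ℕ), (0 : ℕ)) ∈ μ.cells :=
    YoungDiagram.mem_iff_lt_colLen.mpr (lt_trans Nat.zero_lt_one hμ)
  have hc1 : ((1 : ℕ), (0 : ℕ)) ∈ μ.cells := YoungDiagram.mem_iff_lt_colLen.mpr hμ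
  set τ : CellPerm μ := Equiv.swap ⟨_, hc0⟩ ⟨_, hc1⟩ with hτ
  have hτcol : ∀ c, (τ c).1.2 = c.1.2 := by
    intro c
    rw [hτ, Equiv.swap_apply_def]
    split_ifs with h1 h2
    · rw [h1]
    · rw [h2]
    · rfl
  have hτsign : Equiv.Perm.sign τ = -1 := Equiv.Perm.sign_swap (by simp)
  set C : Finset (CellPerm μ) :=
    Finset.univ.filter (fun v : CellPerm μ => ∀ c, (v c).1.2 = c.1.2) with hC
  have hsum : ∑ v ∈ C, (((Equiv.Perm.sign v : ℤ) : ℂ)) = 0 := by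
    have h1 : ∑ v ∈ C, (((Equiv.Perm.sign v : ℤ) : ℂ)) =
        ∑ v ∈ C, -(((Equiv.Perm.sign v : ℤ) : ℂ)) := by
      refine Finset.sum_nbij' (fun v => τ * v) (fun v => τ * v) ?_ ?_ ?_ ?_ ?_
      · intro v hv
        simp only [hC, Finset.mem_filter, Finset.mem_univ, true_and] at hv ⊢
        intro c
        rw [Equiv.Perm.mul_apply, hτcol, hv]
      · intro v hv
        simp only [hC, Finset.mem_filter, Finset.mem_univ, true_and] at hv ⊢
        intro c
        rw [Equiv.Perm.mul_apply, hτcol, hv]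
      · intro v _
        rw [hτ, Equiv.swap_mul_self_mul]
      · intro v _
        rw [hτ, Equiv.swap_mul_self_mul]
      · intro v _
        rw [Equiv.Perm.sign_mul, hτsign]
        simp
    rw [Finset.sum_neg_distrib] at h1
    linear_combination h1 / 2
  have hcol : groupSum (CellPerm μ) *
      ∑ v ∈ C, MonoidAlgebra.single v (((Equiv.Perm.sign v : ℤ) : ℂ)) = 0 := by
    rw [Finset.mul_sum]
    simp_rw [groupSum_mul_single]
    rw [← Finset.sum_smul, hsum, zero_smul]
  rw [youngSymmetrizer, ← mul_assoc]
  obtain ⟨c, hc⟩ := exists_groupSum_mul (∑ u ∈ Finset.univ.filter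
    (fun u : CellPerm μ => ∀ c, (u c).1.1 = c.1.1), MonoidAlgebra.single u (1 : ℂ))
  have hdec : ∀ (p : CellPerm μ → Prop) (d d' : DecidablePred p),
      @Finset.filter _ p d Finset.univ = @Finset.filter _ p d' Finset.univ := by
    intro p d d'
    congr!
  rw [hdec _ _ (fun u => inferInstance), hc, smul_mul_assoc]
  rw [hC] at hcol
  rw [hdec _ _ (fun u => inferInstance), hcol, smul_zero]

theorem sum_spechtCharacter_eq_zero {μ : YoungDiagram} (hμ : 1 < len μ) :
    ∑ g, spechtCharacter μ g = 0 := by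
  rw [sum_spechtCharacter]
  have h : Algebra.lsmul ℂ ℂ (specht μ) (groupSum (CellPerm μ)) = 0 := by
    ext1 ⟨x, hx⟩
    obtain ⟨y, rfl⟩ := Submodule.mem_span_singleton.mp hx
    refine Subtype.ext ?_
    change groupSum (CellPerm μ) * (y * youngSymmetrizer μ) = 0
    obtain ⟨c, hc⟩ := exists_groupSum_mul y
    rw [← mul_assoc, hc, smul_mul_assoc, groupSum_mul_youngSymmetrizer hμ, smul_zero]
  rw [h, map_zero]

theorem youngSymmetrizer_of_len_le {μ : YoungDiagram} (hμ : len μ ≤ 1) :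
    youngSymmetrizer μ = groupSum (CellPerm μ) := by
  classical
  have hrow : ∀ c : {c : ℕ × ℕ // c ∈ μ.cells}, c.1.1 = 0 := by
    rintro ⟨⟨i, j⟩, hc⟩
    have h1 : i < μ.colLen j := YoungDiagram.mem_iff_lt_colLen.mp hc
    have h2 := μ.colLen_anti 0 j (Nat.zero_le j)
    rw [len] at hμ
    simp only
    omega
  have h1 : ∀ u : CellPerm μ, ∀ c, (u c).1.1 = c.1.1 := fun u c => by rw [hrow, hrow]
  have h2 : ∀ v : CellPerm μ, (∀ c, (v c).1.2 = c.1.2) ↔ v = 1 := by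
    intro v
    constructor
    · intro h
      ext1 c
      exact Subtype.ext (Prod.ext (h1 v c) (h c))
    · rintro rfl c
      rfl
  have hA : ∀ d : DecidablePred (fun u : CellPerm μ => ∀ c, (u c).1.1 = c.1.1),
      @Finset.filter _ _ d Finset.univ = Finset.univ := fun d =>
    Finset.filter_true_of_mem fun u _ => h1 u
  have hB : ∀ d : DecidablePred (fun v : CellPerm μ => ∀ c, (v c).1.2 = c.1.2),
      @Finset.filter _ _ d Finset.univ = {1} := by
    intro d
    ext v
    rw [Finset.mem_filter, h2, Finset.mem_singleton]
    exact and_iff_right (Finset.mem_univ v)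
  rw [youngSymmetrizer, hA, hB, Finset.sum_singleton, groupSum, Equiv.Perm.sign_one]
  have h3 : MonoidAlgebra.single (1 : CellPerm μ) (((1 : ℤˣ) : ℤ) : ℂ) = 1 := by
    simp [MonoidAlgebra.one_def]
  rw [h3, mul_one]

theorem spechtCharacter_of_len_le {μ : YoungDiagram} (hμ : len μ ≤ 1) (g : CellPerm μ) :
    spechtCharacter μ g = 1 := by
  have hmem : groupSum (CellPerm μ) ∈ specht μ := by
    rw [← youngSymmetrizer_of_len_le hμ]
    exact Ideal.mem_span_singleton_self _
  have hspan : ∀ x : specht μ, ∃ c : ℂ, c • (⟨groupSum (CellPerm μ), hmem⟩ : specht μ) = x := by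
    rintro ⟨x, hx⟩
    obtain ⟨y, rfl⟩ := Submodule.mem_span_singleton.mp hx
    obtain ⟨c, hc⟩ := exists_mul_groupSum y
    refine ⟨c, Subtype.ext ?_⟩
    rw [← youngSymmetrizer_of_len_le hμ] at hc
    change c • groupSum (CellPerm μ) = y * youngSymmetrizer μ
    rw [hc, youngSymmetrizer_of_len_le hμ]
  have hrank : Module.finrank ℂ (specht μ) = 1 :=
    finrank_eq_one _ (fun h => groupSum_ne_zero (congrArg Subtype.val h)) hspan
  have hone : Algebra.lsmul ℂ ℂ (specht μ) (MonoidAlgebra.single g (1 : ℂ)) = 1 := by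
    ext1 x
    obtain ⟨c, rfl⟩ := hspan x
    rw [map_smul]
    refine congrArg (c • ·) (Subtype.ext ?_)
    change MonoidAlgebra.single g (1 : ℂ) * groupSum (CellPerm μ) = groupSum (CellPerm μ)
    rw [single_mul_groupSum, one_smul]
  rw [spechtCharacter, hone, LinearMap.trace_one, hrank, Nat.cast_one]

/-! ### Sums over cycle types -/

theorem zee_toFinsupp (s : Multiset ℕ) :
    zee (Multiset.toFinsupp s) = s.prod * ∏ i ∈ s.toFinset, (s.count i).factorial := by
  rw [zee, Finsupp.prod, Multiset.toFinsupp_support, Finset.prod_mul_distrib,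
    Finset.prod_multiset_count]
  simp only [Multiset.toFinsupp_apply]

/-- The conjugacy class with cycle type `P`, fixed points counted as parts, has `n! / z_P`
elements. -/
theorem card_partition_mul_zee {α : Type*} [Fintype α] [DecidableEq α]
    (P : (Fintype.card α).Partition) :
    (Finset.univ.filter fun g : Equiv.Perm α => g.partition = P).card *
      zee (Multiset.toFinsupp P.parts) = (Fintype.card α).factorial := by
  set m := P.parts.filter (2 ≤ ·) with hm
  have hparts : P.parts = m + Multiset.replicate (P.parts.count 1) 1 := by
    rw [← Multiset.filter_eq', ← Multiset.filter_add_not (2 ≤ ·) P.parts, ← hm]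
    congr 1
    rw [Multiset.filter_add_not]
    refine Multiset.filter_congr fun x hx => ?_
    have := P.parts_pos hx
    omega
  have hsum : m.sum + P.parts.count 1 = Fintype.card α := by
    have h := P.parts_sum
    rw [hparts, Multiset.sum_add, Multiset.sum_replicate, smul_eq_mul, mul_one] at h
    exact h
  have hset : (Finset.univ.filter fun g : Equiv.Perm α => g.partition = P) =
      Finset.univ.filter fun g : Equiv.Perm α => g.cycleType = m := by
    refine Finset.filter_congr fun g _ => ?_
    constructor
    · rintro rfl
      exact Equiv.Perm.filter_parts_partition_eq_cycleType.symm
    · intro h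
      refine Nat.Partition.ext ?_
      rw [Equiv.Perm.parts_partition, hparts, h, ← Equiv.Perm.sum_cycleType, h]
      congr 2
      omega
  have hcard := Equiv.Perm.card_of_cycleType_mul_eq α m
  rw [if_pos ⟨by omega, fun a ha => (Multiset.mem_filter.mp ha).2⟩] at hcard
  rw [hset, ← hcard]
  congr 1
  have hsub : P.parts.toFinset ⊆ insert 1 m.toFinset := by
    intro i hi
    rw [Multiset.mem_toFinset] at hi
    have := P.parts_pos hi
    rw [Finset.mem_insert, Multiset.mem_toFinset, hm, Multiset.mem_filter]
    by_cases h1 : i = 1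
    · exact Or.inl h1
    · exact Or.inr ⟨hi, by omega⟩
  have h1m : 1 ∉ m.toFinset := by
    rw [Multiset.mem_toFinset, hm, Multiset.mem_filter]
    omega
  have hprod : P.parts.prod = m.prod := by
    rw [hparts, Multiset.prod_add, Multiset.prod_replicate, one_pow, mul_one]
  have hcount : ∏ i ∈ m.toFinset, (P.parts.count i).factorial =
      ∏ i ∈ m.toFinset, (m.count i).factorial := by
    refine Finset.prod_congr rfl fun i hi => ?_
    rw [Multiset.mem_toFinset, hm, Multiset.mem_filter] at hi
    rw [hm, Multiset.count_filter_of_pos hi.2]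
  rw [zee_toFinsupp, Finset.prod_subset hsub, Finset.prod_insert h1m, hprod, hcount]
  · have : Fintype.card α - m.sum = P.parts.count 1 := by omega
    rw [this]
    ring
  · intro i _ hi
    rw [Multiset.mem_toFinset] at hi
    rw [Multiset.count_eq_zero_of_notMem hi, Nat.factorial_zero]

theorem card_cells (μ : YoungDiagram) : Fintype.card {c : ℕ × ℕ // c ∈ μ.cells} = μ.card :=
  Fintype.card_coe μ.cells

/-- The choice of a permutation in `charValue` is immaterial, characters being class functions. -/
theorem charValue_partition (μ : YoungDiagram) (g : CellPerm μ) :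
    charValue μ (Multiset.toFinsupp g.partition.parts) = spechtCharacter μ g := by
  classical
  have h : ∃ g' : CellPerm μ, Multiset.toFinsupp g'.partition.parts =
      Multiset.toFinsupp g.partition.parts := ⟨g, rfl⟩
  rw [charValue, dif_pos h]
  refine spechtCharacter_conj μ (Equiv.Perm.partition_eq_of_isConj.mpr (Nat.Partition.ext ?_))
  exact Multiset.toFinsupp.injective h.choose_spec

theorem sum_charValue_div_zee (μ : YoungDiagram) :
    ∑ P : μ.card.Partition, charValue μ (Multiset.toFinsupp P.parts) /
        (zee (Multiset.toFinsupp P.parts) : ℂ) =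
      if len μ ≤ 1 then 1 else 0 := by
  classical
  rw [← card_cells μ]
  have hfac : ((Fintype.card {c : ℕ × ℕ // c ∈ μ.cells}).factorial : ℂ) ≠ 0 := by
    exact_mod_cast Nat.factorial_ne_zero _
  have hterm : ∀ P : (Fintype.card {c : ℕ × ℕ // c ∈ μ.cells}).Partition,
      charValue μ (Multiset.toFinsupp P.parts) / (zee (Multiset.toFinsupp P.parts) : ℂ) =
        ((Fintype.card {c : ℕ × ℕ // c ∈ μ.cells}).factorial : ℂ)⁻¹ *
          ∑ g ∈ Finset.univ.filter (fun g : CellPerm μ => g.partition = P),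
            spechtCharacter μ g := by
    intro P
    have hc := card_partition_mul_zee P
    have h1 : ∑ g ∈ Finset.univ.filter (fun g : CellPerm μ => g.partition = P),
        spechtCharacter μ g = ((Finset.univ.filter fun g : CellPerm μ => g.partition = P).card : ℂ) *
          charValue μ (Multiset.toFinsupp P.parts) := by
      rw [← nsmul_eq_mul, ← Finset.sum_const]
      refine Finset.sum_congr rfl fun g hg => ?_
      rw [← (Finset.mem_filter.mp hg).2, charValue_partition]
    have hz : (zee (Multiset.toFinsupp P.parts) : ℂ) ≠ 0 := by
      intro h
      rw [Nat.cast_eq_zero] at h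
      rw [h, mul_zero] at hc
      exact (Nat.factorial_ne_zero _) hc.symm
    have hcC := congrArg (Nat.cast : ℕ → ℂ) hc
    push_cast at hcC
    rw [h1, div_eq_iff hz, inv_mul_eq_div, div_mul_eq_mul_div, eq_div_iff hfac, ← hcC]
    ring
  simp_rw [hterm]
  rw [← Finset.mul_sum, Finset.sum_fiberwise]
  split_ifs with hμ
  · simp_rw [spechtCharacter_of_len_le hμ]
    rw [Finset.sum_const, Finset.card_univ, Fintype.card_perm, nsmul_eq_mul, mul_one,
      inv_mul_cancel₀ hfac]
  · rw [sum_spechtCharacter_eq_zero (not_le.mp hμ), mul_zero]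

/-! ### Partitions as multisets of parts -/

theorem sum_rowLens (μ : YoungDiagram) : μ.rowLens.sum = μ.card := by
  rw [card_eq_sum_rowLen (le_refl (len μ)), YoungDiagram.rowLens, len,
    Finset.sum_fin_eq_sum_range, Finset.sum_range, Fin.sum_univ_def, ← List.map_coe_finRange_eq_range,
    List.map_map]
  simp [Function.comp_def]

theorem rowLens_injective : Function.Injective YoungDiagram.rowLens := by
  intro μ ν h
  rw [← YoungDiagram.ofRowLens_to_rowLens_eq_self (μ := μ),
    ← YoungDiagram.ofRowLens_to_rowLens_eq_self (μ := ν)]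
  congr 1

theorem sum_partitionsOf_eq {A : Type*} [AddCommMonoid A] (d : ℕ) (f : (ℕ →₀ ℕ) → A) :
    ∑ μ ∈ partitionsOf d, f (multiplicities μ) =
      ∑ P : d.Partition, f (Multiset.toFinsupp P.parts) := by
  refine Finset.sum_bij (fun μ hμ => (⟨(μ.rowLens : Multiset ℕ),
    fun {i} hi => μ.pos_of_mem_rowLens i hi, by
      rw [Multiset.sum_coe, sum_rowLens, mem_partitionsOf.mp hμ]⟩ : d.Partition)) ?_ ?_ ?_ ?_
  · intro μ _
    exact Finset.mem_univ _
  · intro μ _ ν _ h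
    have h1 : (μ.rowLens : Multiset ℕ) = ν.rowLens := congrArg Nat.Partition.parts h
    exact rowLens_injective ((Multiset.coe_eq_coe.mp h1).eq_of_pairwise'
      μ.rowLens_sorted.pairwise ν.rowLens_sorted.pairwise)
  · intro P _
    have hs : (P.parts.sort (· ≥ ·)).SortedGE := (P.parts.pairwise_sort (· ≥ ·)).sortedGE
    have hpos : ∀ x ∈ P.parts.sort (· ≥ ·), 0 < x := fun x hx =>
      P.parts_pos ((Multiset.mem_sort (r := (· ≥ ·))).mp hx)
    have hrow := YoungDiagram.rowLens_ofRowLens_eq_self (hw := hs) hpos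
    refine ⟨YoungDiagram.ofRowLens _ hs, ?_, ?_⟩
    · rw [mem_partitionsOf, ← sum_rowLens, hrow, ← Multiset.sum_coe, Multiset.sort_eq,
        P.parts_sum]
    · refine Nat.Partition.ext ?_
      change ((YoungDiagram.ofRowLens _ hs).rowLens : Multiset ℕ) = P.parts
      rw [hrow, Multiset.sort_eq]
  · intro μ _
    rfl

theorem size_toFinsupp (s : Multiset ℕ) : size (Multiset.toFinsupp s) = s.sum := by
  rw [size, Finsupp.sum, Multiset.toFinsupp_support, Finset.sum_multiset_count]
  simp [mul_comm]

theorem degree_toFinsupp (s : Multiset ℕ) : (Multiset.toFinsupp s).degree = s.card :=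
  Multiset.toFinsupp_sum_eq s

theorem degree_multiplicities (μ : YoungDiagram) : (multiplicities μ).degree = len μ := by
  rw [multiplicities, degree_toFinsupp, Multiset.coe_card, YoungDiagram.length_rowLens, len]

/-! ### The substitution `p_k ↦ √-1 x^k` -/

/-- The values `p_k = √-1 x^k` at which the partition function evaluates the open amplitude; the
variable with index `0`, which does not occur, is sent to `0`. -/
def powerSumValue (k : ℕ) : PowerSeries CoeffRing :=
  if k = 0 then 0 else PowerSeries.C (const Complex.I) * PowerSeries.X ^ k

theorem hasSubst_powerSumValue :
    MvPowerSeries.HasSubst (S := CoeffRing) (τ := Unit) powerSumValue where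
  const_coeff k := by
    have h : PowerSeries.constantCoeff (powerSumValue k) = 0 := by
      rw [powerSumValue]
      split_ifs with hk
      · simp
      · simp [hk]
    change IsNilpotent (PowerSeries.constantCoeff (powerSumValue k))
    rw [h]
    exact IsNilpotent.zero
  coeff_zero e := by
    refine (Set.finite_Iic (e ())).subset fun k hk => ?_
    by_contra hlt
    rw [Set.mem_Iic, not_le] at hlt
    apply hk
    have he : e = Finsupp.single () (e ()) := by
      ext
      simp
    rw [he]
    change PowerSeries.coeff (e ()) (powerSumValue k) = 0
    rw [powerSumValue]
    split_ifs with h0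
    · simp
    · rw [PowerSeries.coeff_C_mul, PowerSeries.coeff_X_pow, if_neg hlt.ne, mul_zero]

/-- The specialization of a power series in `p_1, p_2, …` at `p_k = √-1 x^k`. -/
def specialize (f : MvPowerSeries ℕ CoeffRing) : PowerSeries CoeffRing :=
  MvPowerSeries.subst powerSumValue f

theorem prod_powerSumValue {m : ℕ →₀ ℕ} (h0 : m 0 = 0) :
    (m.prod fun k e => powerSumValue k ^ e) =
      PowerSeries.C (const Complex.I ^ m.degree) * PowerSeries.X ^ size m := by
  have h1 : (m.prod fun k e => powerSumValue k ^ e) =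
      m.prod fun k e => PowerSeries.C (const Complex.I) ^ e * PowerSeries.X ^ (k * e) := by
    refine Finsupp.prod_congr fun k hk => ?_
    have hk0 : k ≠ 0 := by
      rintro rfl
      exact (Finsupp.mem_support_iff.mp hk) h0
    rw [powerSumValue, if_neg hk0, mul_pow, pow_mul]
  rw [h1, Finsupp.prod, Finset.prod_mul_distrib, Finset.prod_pow_eq_pow_sum,
    Finset.prod_pow_eq_pow_sum, map_pow]
  rfl

theorem prod_powerSumValue_eq_zero {m : ℕ →₀ ℕ} (h0 : m 0 ≠ 0) :
    (m.prod fun k e => powerSumValue k ^ e) = 0 := by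
  refine Finset.prod_eq_zero (Finsupp.mem_support_iff.mpr h0) ?_
  have h : powerSumValue 0 = 0 := if_pos rfl
  change powerSumValue 0 ^ m 0 = 0
  rw [h, zero_pow h0]

theorem coeff_specialize (f : MvPowerSeries ℕ CoeffRing) (d : ℕ) :
    PowerSeries.coeff d (specialize f) = ∑ μ ∈ partitionsOf d,
      const Complex.I ^ (len μ) * MvPowerSeries.coeff (multiplicities μ) f := by
  classical
  have hR : ∑ μ ∈ partitionsOf d,
      const Complex.I ^ (len μ) * MvPowerSeries.coeff (multiplicities μ) f =
      ∑ P : d.Partition, const Complex.I ^ (Multiset.toFinsupp P.parts).degree *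
        MvPowerSeries.coeff (Multiset.toFinsupp P.parts) f := by
    rw [← sum_partitionsOf_eq d fun m => const Complex.I ^ m.degree * MvPowerSeries.coeff m f]
    refine Finset.sum_congr rfl fun μ _ => ?_
    rw [degree_multiplicities]
  have hL : PowerSeries.coeff d (specialize f) = ∑ᶠ m : ℕ →₀ ℕ, MvPowerSeries.coeff m f •
      PowerSeries.coeff d (m.prod fun k e => powerSumValue k ^ e) :=
    MvPowerSeries.coeff_subst hasSubst_powerSumValue f (Finsupp.single () d)
  have hinj : Function.Injective fun P : d.Partition => Multiset.toFinsupp P.parts := fun P Q h =>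
    Nat.Partition.ext (Multiset.toFinsupp.injective h)
  rw [hR, hL, finsum_eq_sum_of_support_subset (s := Finset.univ.image
    fun P : d.Partition => Multiset.toFinsupp P.parts), Finset.sum_image hinj.injOn]
  · refine Finset.sum_congr rfl fun P _ => ?_
    have h0 : Multiset.toFinsupp P.parts 0 = 0 := by
      rw [Multiset.toFinsupp_apply, Multiset.count_eq_zero]
      intro h
      exact lt_irrefl _ (P.parts_pos h)
    rw [prod_powerSumValue h0, PowerSeries.coeff_C_mul, PowerSeries.coeff_X_pow, size_toFinsupp,
      P.parts_sum, if_pos rfl, mul_one, smul_eq_mul, mul_comm]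
  · intro m hm
    rw [Function.mem_support] at hm
    rw [Finset.coe_image, Finset.coe_univ, Set.image_univ, Set.mem_range]
    have h0 : m 0 = 0 := by
      by_contra h0
      rw [prod_powerSumValue_eq_zero h0] at hm
      simp at hm
    rw [prod_powerSumValue h0, PowerSeries.coeff_C_mul, PowerSeries.coeff_X_pow] at hm
    have hd : d = size m := by
      by_contra hd
      rw [if_neg hd] at hm
      simp at hm
    have hm' : Multiset.toFinsupp (Finsupp.toMultiset m) = m :=
      Finsupp.toMultiset_toFinsupp m
    refine ⟨⟨Finsupp.toMultiset m, fun {i} hi => ?_, ?_⟩, hm'⟩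
    · rw [Finsupp.mem_toMultiset, Finsupp.mem_support_iff] at hi
      refine Nat.pos_of_ne_zero fun h => hi ?_
      rw [h, h0]
    · rw [hd, ← size_toFinsupp, hm']

theorem exp_subst_log_subst {R : Type*} [CommRing R] [Algebra ℚ R] {B : R⟦X⟧}
    (hB : PowerSeries.constantCoeff B = 1) :
    (PowerSeries.exp ℚ).subst ((PowerSeries.log ℚ).subst (B - 1)) = B := by
  have hs : PowerSeries.HasSubst (B - 1) :=
    PowerSeries.HasSubst.of_constantCoeff_zero' (by simp [hB])
  rw [← PowerSeries.subst_comp_subst_apply PowerSeries.HasSubst.log hs, exp_subst_log,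
    PowerSeries.subst_add hs, PowerSeries.subst_X hs]
  have h1 : (1 : ℚ⟦X⟧).subst (B - 1) = 1 := by
    rw [← PowerSeries.coe_substAlgHom hs, map_one]
  rw [h1]
  ring

theorem specialize_sub_one (f : MvPowerSeries ℕ CoeffRing) :
    specialize (f - 1) = specialize f - 1 := by
  have h := map_sub (MvPowerSeries.substAlgHom hasSubst_powerSumValue (R := CoeffRing)) f 1
  rw [map_one] at h
  rw [MvPowerSeries.coe_substAlgHom] at h
  exact h

theorem specialize_log (f : MvPowerSeries ℕ CoeffRing) (hf : MvPowerSeries.constantCoeff f = 1) :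
    specialize ((PowerSeries.log ℚ).subst (f - 1)) =
      (PowerSeries.log ℚ).subst (specialize f - 1) := by
  have hs : PowerSeries.HasSubst (f - 1) :=
    PowerSeries.HasSubst.of_constantCoeff_zero (by simp [hf])
  rw [← specialize_sub_one]
  exact MvPowerSeries.subst_comp_subst_apply hs.const hasSubst_powerSumValue _

theorem len_bot : len ⊥ = 0 := Nat.le_zero.mp ((len_le_card _).trans (by simp))

theorem multiplicities_bot : multiplicities ⊥ = 0 := by
  have h : (⊥ : YoungDiagram).rowLens = [] := by
    rw [← List.length_eq_zero_iff, YoungDiagram.length_rowLens]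
    exact len_bot
  rw [multiplicities, h]
  simp

theorem constantCoeff_specialize (f : MvPowerSeries ℕ CoeffRing) :
    PowerSeries.constantCoeff (specialize f) = MvPowerSeries.constantCoeff f := by
  rw [← PowerSeries.coeff_zero_eq_constantCoeff_apply, coeff_specialize, partitionsOf_zero,
    Finset.sum_singleton, len_bot, multiplicities_bot, pow_zero, one_mul,
    MvPowerSeries.coeff_zero_eq_constantCoeff_apply]

/-! ### The partition function as a specialization -/

/-- There are `n!` pairs of an exponent vector `e` and a permutation matching it with the parts of a
partition with `n` parts. -/
theorem sum_card_perm_eq {n d : ℕ} {μ : YoungDiagram} (hμ : μ.card = d) (hn : len μ = n) :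
    ∑ e ∈ Finset.finsuppAntidiag (Finset.univ : Finset (Fin n)) d,
      ((Finset.univ : Finset (Equiv.Perm (Fin n))).filter
        (fun σ => ∀ i : Fin n, e (σ i) = μ.rowLen i)).card = n.factorial := by
  simp_rw [Finset.card_filter]
  rw [Finset.sum_comm]
  have h : ∀ σ : Equiv.Perm (Fin n),
      ∑ e ∈ Finset.finsuppAntidiag (Finset.univ : Finset (Fin n)) d,
        (if ∀ i : Fin n, e (σ i) = μ.rowLen i then 1 else 0) = 1 := by
    intro σ
    set e₀ : Fin n →₀ ℕ := Finsupp.equivFunOnFinite.symm fun i => μ.rowLen (σ⁻¹ i : Fin n) with he₀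
    have happ : ∀ i, e₀ i = μ.rowLen (σ⁻¹ i : Fin n) := fun i => rfl
    rw [Finset.sum_eq_single e₀, if_pos]
    · intro i
      rw [happ, Equiv.Perm.inv_def, Equiv.symm_apply_apply]
    · intro e _ hne
      rw [if_neg]
      intro he
      apply hne
      ext i
      rw [happ, ← he, Equiv.Perm.inv_def, Equiv.apply_symm_apply]
    · intro hmem
      exfalso
      apply hmem
      rw [Finset.mem_finsuppAntidiag]
      refine ⟨?_, Finset.subset_univ _⟩
      rw [← hμ, card_eq_sum_rowLen hn.le]
      exact Equiv.sum_comp σ⁻¹ fun i : Fin n => μ.rowLen i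
  rw [Finset.sum_congr rfl fun σ _ => h σ, Finset.sum_const, Finset.card_univ, Fintype.card_perm,
    Fintype.card_fin, smul_eq_mul, mul_one]

theorem coeff_diagonal (a : ℤ) (n d : ℕ) :
    PowerSeries.coeff d (diagonal a n) = (n.factorial : CoeffRing) *
      ∑ μ ∈ (partitionsOf d).filter (fun μ => len μ = n),
        const Complex.I ^ len μ * freeEnergyCoeff a μ := by
  rw [diagonal, PowerSeries.coeff_mk]
  have h1 : ∀ e ∈ Finset.finsuppAntidiag (Finset.univ : Finset (Fin n)) d,
      MvPowerSeries.coeff e (symmetrized a n) =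
      ∑ μ ∈ (partitionsOf d).filter (fun μ => len μ = n),
        (((Finset.univ : Finset (Equiv.Perm (Fin n))).filter
          (fun σ => ∀ i : Fin n, e (σ i) = μ.rowLen i)).card : CoeffRing) *
        (const Complex.I ^ len μ * freeEnergyCoeff a μ) := by
    intro e he
    have hd : e.degree = d := by
      rw [Finset.mem_finsuppAntidiag] at he
      rw [Finsupp.degree_eq_sum]
      exact he.1
    change ∑ μ ∈ (partitionsOf e.degree).filter (fun μ => len μ = n), _ = _
    rw [hd]
    refine Finset.sum_congr rfl fun μ hμ => ?_
    rw [Finset.sum_const, nsmul_eq_mul, (Finset.mem_filter.mp hμ).2, map_pow]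
  rw [Finset.sum_congr rfl h1, Finset.sum_comm, Finset.mul_sum]
  refine Finset.sum_congr rfl fun μ hμ => ?_
  rw [Finset.mem_filter] at hμ
  rw [← Finset.sum_mul, ← Nat.cast_sum, sum_card_perm_eq (mem_partitionsOf.mp hμ.1) hμ.2]

theorem const_inv_mul_factorial (n : ℕ) :
    const ((n.factorial : ℂ)⁻¹) * (n.factorial : CoeffRing) = 1 := by
  have h : (n.factorial : CoeffRing) = const (n.factorial : ℂ) := (map_natCast const _).symm
  have h0 : (n.factorial : ℂ) ≠ 0 := by exact_mod_cast n.factorial_ne_zero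
  rw [h, ← map_mul, inv_mul_cancel₀ h0, map_one]

theorem logPartitionFunction_eq (a : ℤ)
    (h0 : MvPowerSeries.constantCoeff (freeEnergy a) = 0) :
    logPartitionFunction a = specialize (freeEnergy a) := by
  refine PowerSeries.ext fun d => ?_
  rw [logPartitionFunction, PowerSeries.coeff_mk]
  rcases Nat.eq_zero_or_pos d with rfl | hd
  · rw [PowerSeries.coeff_zero_eq_constantCoeff_apply, constantCoeff_specialize, h0]
    simp
  rw [coeff_specialize, ← Finset.sum_fiberwise_of_maps_to (g := len) (t := Finset.Icc 1 d)]
  · refine Finset.sum_congr rfl fun n _ => ?_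
    rw [coeff_diagonal, ← mul_assoc, const_inv_mul_factorial, one_mul]
    rfl
  · intro μ hμ
    rw [mem_partitionsOf] at hμ
    rw [Finset.mem_Icc]
    refine ⟨?_, hμ ▸ len_le_card μ⟩
    by_contra! h
    have h1 := card_eq_sum_rowLen (μ := μ) (N := 0) (by omega)
    rw [Finset.univ_eq_empty, Finset.sum_empty] at h1
    omega

theorem eq_rowDiagram_of_len_le {μ : YoungDiagram} (h : len μ ≤ 1) : μ = rowDiagram μ.card := by
  refine ext_rowLen fun i => ?_
  rw [rowLen_rowDiagram, card_eq_sum_rowLen h]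
  split_ifs with hi
  · simp [hi]
  · exact rowLen_eq_zero (by omega)

/-- Only one-row partitions survive: `∑_η χ_μ(η) / z_η` is the multiplicity of the trivial
representation in `R_μ`. -/
theorem coeff_specialize_openAmplitude (a : ℤ) (d : ℕ) :
    PowerSeries.coeff d (specialize (openAmplitude a)) =
      PowerSeries.C (qPow ((a : ℂ) * ((d : ℂ) * ((d : ℂ) - 1)) / 2)) *
        braneAmplitude (rowDiagram d) := by
  have hterm : ∀ P : d.Partition, const Complex.I ^ (Multiset.toFinsupp P.parts).degree *
      MvPowerSeries.coeff (Multiset.toFinsupp P.parts) (openAmplitude a) =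
      ∑ μ ∈ partitionsOf d, PowerSeries.C (qPow ((a : ℂ) * (kappa μ : ℂ) / 2)) *
        braneAmplitude μ * const (charValue μ (Multiset.toFinsupp P.parts) /
          (zee (Multiset.toFinsupp P.parts) : ℂ)) := by
    intro P
    have hsize : size (Multiset.toFinsupp P.parts) = d := by rw [size_toFinsupp, P.parts_sum]
    change _ * (∑ μ ∈ partitionsOf (size (Multiset.toFinsupp P.parts)), _) = _
    rw [hsize, Finset.mul_sum]
    refine Finset.sum_congr rfl fun μ _ => ?_
    rw [mul_left_comm, ← map_pow, ← map_mul]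
    congr 2
    have hI : Complex.I ^ (Multiset.toFinsupp P.parts).degree ≠ 0 := pow_ne_zero _ Complex.I_ne_zero
    rw [← div_div, mul_div_cancel₀ _ hI]
  have hP : PowerSeries.coeff d (specialize (openAmplitude a)) =
      ∑ P : d.Partition, const Complex.I ^ (Multiset.toFinsupp P.parts).degree *
        MvPowerSeries.coeff (Multiset.toFinsupp P.parts) (openAmplitude a) := by
    rw [coeff_specialize, ← sum_partitionsOf_eq d fun m => const Complex.I ^ m.degree *
      MvPowerSeries.coeff m (openAmplitude a)]
    refine Finset.sum_congr rfl fun μ _ => ?_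
    rw [degree_multiplicities]
  rw [hP, Finset.sum_congr rfl fun P _ => hterm P, Finset.sum_comm]
  simp_rw [← Finset.mul_sum, ← map_sum]
  have hsum : ∀ μ ∈ partitionsOf d, ∑ P : d.Partition, charValue μ (Multiset.toFinsupp P.parts) /
      (zee (Multiset.toFinsupp P.parts) : ℂ) = if len μ ≤ 1 then 1 else 0 := by
    intro μ hμ
    obtain rfl := mem_partitionsOf.mp hμ
    exact sum_charValue_div_zee μ
  rw [Finset.sum_eq_single (rowDiagram d)]
  · rw [hsum _ (mem_partitionsOf.mpr (card_rowDiagram d)), if_pos (len_rowDiagram_le d), map_one,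
      mul_one, kappa_rowDiagram]
    push_cast
    rfl
  · intro μ hμ hne
    rw [hsum μ hμ, if_neg, map_zero, mul_zero]
    intro h
    have h1 := eq_rowDiagram_of_len_le h
    rw [mem_partitionsOf.mp hμ] at h1
    exact hne h1
  · intro h
    exact absurd (mem_partitionsOf.mpr (card_rowDiagram d)) h

theorem constantCoeff_openAmplitude (a : ℤ) :
    MvPowerSeries.constantCoeff (openAmplitude a) = braneAmplitude ⊥ := by
  rw [← constantCoeff_specialize, ← PowerSeries.coeff_zero_eq_constantCoeff_apply,
    coeff_specialize_openAmplitude, rowDiagram_zero]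
  simp [qPow_zero]

theorem inv_braneAmplitude_mul : (braneAmplitude ⊥)⁻¹ * braneAmplitude ⊥ = 1 :=
  PowerSeries.inv_mul_cancel _ (by rw [constantCoeff_braneAmplitude_bot]; exact one_ne_zero)

theorem constantCoeff_normalizedAmplitude (a : ℤ) :
    MvPowerSeries.constantCoeff (normalizedAmplitude a) = 1 := by
  rw [normalizedAmplitude, map_mul, MvPowerSeries.constantCoeff_C, constantCoeff_openAmplitude,
    inv_braneAmplitude_mul]

theorem partitionFunction_eq (a : ℤ) :
    partitionFunction a = specialize (normalizedAmplitude a) := by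
  have h1 := constantCoeff_normalizedAmplitude a
  have h2 : MvPowerSeries.constantCoeff (freeEnergy a) = 0 := by
    rw [freeEnergy]
    exact PowerSeries.constantCoeff_subst_eq_zero (by simp [h1]) _ PowerSeries.constantCoeff_log
  rw [partitionFunction, logPartitionFunction_eq a h2, freeEnergy, specialize_log _ h1]
  exact exp_subst_log_subst (by rw [constantCoeff_specialize, h1])

/-- The coefficients of the partition function: `Z = ∑_n q^{a n(n-1)/2} P_n x^n`, where `P_n` is the
relative amplitude of the one-row partition `(n)`. -/
theorem coeff_partitionFunction (a : ℤ) (d : ℕ) :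
    PowerSeries.coeff d (partitionFunction a) =
      PowerSeries.C (qPow ((a : ℂ) * ((d : ℂ) * ((d : ℂ) - 1)) / 2)) * rowAmplitude d := by
  have h : PowerSeries.coeff d (specialize (normalizedAmplitude a)) =
      (braneAmplitude ⊥)⁻¹ * PowerSeries.coeff d (specialize (openAmplitude a)) := by
    rw [coeff_specialize, coeff_specialize, Finset.mul_sum]
    refine Finset.sum_congr rfl fun μ _ => ?_
    rw [normalizedAmplitude, MvPowerSeries.coeff_C_mul, constantCoeff_openAmplitude]
    ring
  rw [partitionFunction_eq, h, coeff_specialize_openAmplitude, braneAmplitude_rowDiagram]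
  linear_combination (PowerSeries.C (qPow ((a : ℂ) * ((d : ℂ) * ((d : ℂ) - 1)) / 2)) *
    rowAmplitude d) * inv_braneAmplitude_mul

/-! ### The quantum curve -/

theorem yHat_zpow (k : ℤ) : ((yHat ^ k : Operatorsˣ) : Operators) = dilation k := by
  induction k using Int.induction_on with
  | zero => rw [zpow_zero, Units.val_one, dilation_zero]
  | succ n ih =>
    rw [zpow_add_one, Units.val_mul, ih]
    exact dilation_mul _ _
  | pred n ih =>
    rw [zpow_sub_one, Units.val_mul, ih]
    exact dilation_mul _ _

theorem coeff_quantumCurve (a : ℤ) (f : PowerSeries CoeffRing) (n : ℕ) :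
    PowerSeries.coeff n (quantumCurve a f) =
      PowerSeries.coeff n f - PowerSeries.coeff n (dilation 1 f) +
        qHalf * PowerSeries.coeff n (PowerSeries.X * dilation (a + 1) f) -
        qHalf * expNegT * PowerSeries.coeff n (PowerSeries.X * dilation a f) := by
  rw [quantumCurve, yHat_zpow, yHat_zpow, ← PowerSeries.coeff_C_mul, ← PowerSeries.coeff_C_mul,
    ← map_sub, ← map_add, ← map_sub]
  rfl

end Conifold

end

theorem mainTheorem5 (a : ℤ) :
    Conifold.quantumCurve a (Conifold.partitionFunction a) = 0 := by
  refine PowerSeries.ext fun n => ?_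
  rw [Conifold.coeff_quantumCurve, Conifold.coeff_dilation, map_zero]
  rcases n with _ | n
  · simp [Conifold.qPow_zero]
  · rw [PowerSeries.coeff_succ_X_mul, PowerSeries.coeff_succ_X_mul, Conifold.coeff_dilation,
      Conifold.coeff_dilation, Conifold.coeff_partitionFunction, Conifold.coeff_partitionFunction]
    have h1 : Conifold.qPow ((a : ℂ) * (((n + 1 : ℕ) : ℂ) * (((n + 1 : ℕ) : ℂ) - 1)) / 2) =
        Conifold.qPow ((a : ℂ) * n) * Conifold.qPow ((a : ℂ) * ((n : ℂ) * ((n : ℂ) - 1)) / 2) := by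
      rw [← Conifold.qPow_add]
      congr 1
      push_cast
      ring
    have h2 : Conifold.qPow (((1 : ℤ) : ℂ) * ((n + 1 : ℕ) : ℂ)) = Conifold.qPow 1 ^ (n + 1) := by
      rw [← Conifold.qPow_nat_mul]
      congr 1
      push_cast
      ring
    have h3 : Conifold.qPow (((a + 1 : ℤ) : ℂ) * (n : ℂ)) =
        Conifold.qPow ((a : ℂ) * n) * Conifold.qPow 1 ^ n := by
      rw [← Conifold.qPow_nat_mul, ← Conifold.qPow_add]
      congr 1
      push_cast
      ring
    rw [h1, h2, h3, map_mul, map_mul, map_pow, map_pow]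
    linear_combination -(PowerSeries.C (Conifold.qPow ((a : ℂ) * n)) * PowerSeries.C
      (Conifold.qPow ((a : ℂ) * ((n : ℂ) * ((n : ℂ) - 1)) / 2))) * Conifold.rowAmplitude_rec n
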